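/- Let $\Omega\subset\mathbb R^2$ be a bounded, connected, polygonal open set with Lipschitz boundary, let $\Gamma^D$ be a relatively open subset of $\partial\Omega$, and let $f\in L^2(\Omega)^3$ and $y_D,G_D\in L^2(\Gamma^D)^3$ (for instance $y_D,G_D\in H^{1/2}(\Gamma^D)^3$). Let $\mathcal T_h$ be a conforming triangulation of $\overline\Omega$ by closed triangles that is shape regular with constant $\sigma>0$: every $T\in\mathcal T_h$, with diameter $h_T$, contains a disc of diameter $h_T/\sigma$. Let $\mathcal E_h^i$ be the set of internal edges (shared by two triangles) and $\mathcal E_h^b$ the set of boundary edges $e$ with (relatively open) $e\subset\Gamma^D$, and put $\mathcal E_h=\mathcal E_h^i\cup\mathcal E_h^b$. Assume that $\mathcal E_h^b\neq\emptyset$. Let $h$ be a mesh-size function, that is, a constant $h_e$ on each edge $e$, with $\kappa^{-1}h_T\le h_e\le\kappa h_T$ whenever $e$ is an edge of $T$, for a constant $\kappa>0$. (For a shape regular mesh this includes the edge length; for a quasi-uniform mesh it includes the global mesh size.) Let $V_h$ be the space of fields $\Omega\to\mathbb R^3$ that are polynomial of total degree at most $2$ on each triangle, without continuity requirement, and denote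 by $\nabla_h,\nabla_h^2$ the piecewise gradient and Hessian. For $e\in\mathcal E_h^i$ fix a unit normal $n=n_e$ and let $v^\pm(x)=\lim_{s\to0^+}v(x\pm s n_e)$; put $[y]=y^--y^+$, $[\nabla_h y]=(\nabla_h y^--\nabla_h y^+)n_e\in\mathbb R^3$ and $\{v\}=\frac12(v^-+v^+)$. For $e\in\mathcal E_h^b$ let $n=n_e$ be the outward unit normal, and put $[y]=y$, $[\nabla_h y]=(\nabla_h y)n_e$, $\{v\}=v$. For $\eta_0,\eta_1>0$ and $y,w\in V_h$ let $$\begin{aligned} a_h(y,w)=&\int_\Omega\nabla_h^2y:\nabla_h^2w\,dx-\sum_{e\in\mathcal E_h}\int_e[\nabla_hy]\cdot(\{\nabla_h^2w\}n)n\,dS-\sum_{e\in\mathcal E_h}\int_e[\nabla_hw]\cdot(\{\nabla_h^2y\}n)n\,dS\\&+\eta_1\sum_{e\in\mathcal E_h}\int_eh^{-1}[\nabla_hy]\cdot[\nabla_hw]\,dS+\eta_0\sum_{e\in\mathcal E_h}\int_eh^{-3}[y]\cdot[w]\,dS,\\ F_h(w)=&\sum_{e\in\mathcal E_h^b}\int_e\Big(-G_D\cdot(\{\nabla_h^2w\}n)n+\eta_1h^{-1}G_D\cdot(\nabla_hw)n+\eta_0h^{-3}y_D\cdot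 w\Big)dS,\\ E_h(y)=&\tfrac12a_h(y,y)-\int_\Omega f\cdot y\,dx-F_h(y).\end{aligned}$$ Let $\mathbb A_h=\{w\in V_h:\ \nabla_hw(x_T)^{\mathsf T}\nabla_hw(x_T)=I_2\ \text{ for all }T\in\mathcal T_h\}$, where $x_T$ is the barycenter of $T$. Then there is a constant $\eta_{\min}>0$, depending only on $\sigma$ and $\kappa$, such that for all $\eta_0>0$ and all $\eta_1\ge\eta_{\min}$: if $\mathbb A_h\ne\emptyset$, then there exists $y_h\in\mathbb A_h$ with $$E_h(y_h)=\inf_{v_h\in\mathbb A_h}E_h(v_h).$$ -/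

import Mathlib

open MeasureTheory Matrix
open scoped Classical

noncomputable section

namespace PlateDG

/-- The plane `ℝ²` with its Euclidean norm. -/
abbrev Plane := EuclideanSpace ℝ (Fin 2)

/-- `ℝ³` with its Euclidean norm. -/
abbrev Space := EuclideanSpace ℝ (Fin 3)

/-- The Stiefel manifold `St(n,m)` of `n × m` matrices with orthonormal columns. -/
def stiefel (n m : ℕ) : Set (Matrix (Fin n) (Fin m) ℝ) :=
  {U | Uᵀ * U = 1}

/-- A bounded planar domain with Lipschitz boundary: near each boundary point and after a
rotation or reflection, `Ω` is the region strictly below the graph of a Lipschitz function. -/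
structure IsLipschitzDomain (Ω : Set Plane) : Prop where
  isOpen : IsOpen Ω
  isConnected : IsConnected Ω
  isBounded : Bornology.IsBounded Ω
  lipschitz : ∀ x ∈ frontier Ω, ∃ (ρ : Plane ≃ₗᵢ[ℝ] Plane) (L : NNReal) (g : ℝ → ℝ) (r : ℝ),
    LipschitzWith L g ∧ 0 < r ∧ ∀ z ∈ Metric.ball x r, z ∈ Ω ↔ ρ z 1 < g (ρ z 0)

/-- A (conforming) triangulation exactly fitting `Ω`: a finite simplicial complex in the plane in
which every simplex is a face of a triangle, and whose triangles cover exactly `closure Ω`.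
In particular its existence makes `Ω` polygonal. -/
structure Triangulation (Ω : Set Plane) where
  complex : Geometry.SimplicialComplex ℝ Plane
  finite : complex.faces.Finite
  pure : ∀ s ∈ complex.faces, ∃ T ∈ complex.faces, T.card = 3 ∧ s ⊆ T
  space_eq : complex.space = closure Ω

namespace Triangulation

variable {Ω : Set Plane} (M : Triangulation Ω)

/-- The triangles of the mesh, each given by its set of three vertices. -/
def Tri : Type := {T : Finset Plane // T ∈ M.complex.faces ∧ T.card = 3}

/-- All edges of the mesh, each given by its set of two end points. -/
def Edge : Type := {e : Finset Plane // e ∈ M.complex.faces ∧ e.card = 2}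

instance : Fintype M.Tri :=
  (M.finite.subset (fun _ h => h.1) : {T | T ∈ M.complex.faces ∧ T.card = 3}.Finite).fintype

instance : Fintype M.Edge :=
  (M.finite.subset (fun _ h => h.1) : {e | e ∈ M.complex.faces ∧ e.card = 2}.Finite).fintype

end Triangulation

/-- The barycenter of a finite set of points. -/
def barycenter (s : Finset Plane) : Plane := (s.card : ℝ)⁻¹ • ∑ v ∈ s, v

/-- The closed triangle with vertex set `T`. -/
def cell (T : Finset Plane) : Set Plane := convexHull ℝ (T : Set Plane)

/-- The edge with end points `e`, without the end points. -/
def edgeSet (e : Finset Plane) : Set Plane := convexHull ℝ (e : Set Plane) \ (e : Set Plane)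

/-- The unit normal to the edge `e` of the triangle `T` that points out of `T`: the normalized
component, orthogonal to `e`, of the vector from the barycenter of `T` to the midpoint of `e`. -/
def outwardNormal (T e : Finset Plane) : Plane :=
  let d : Plane :=
    (vectorSpan ℝ (e : Set Plane))ᗮ.starProjection (barycenter e - barycenter T)
  ‖d‖⁻¹ • d

/-- Length (one-dimensional Hausdorff) measure in the plane. -/
abbrev lengthMeasure : Measure Plane := μH[1]

namespace Triangulation

variable {Ω : Set Plane} (M : Triangulation Ω)

/-- Internal edges: those shared by two different triangles. The other edges of the
triangulation are the boundary edges. -/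
def IsInterior (e : M.Edge) : Prop :=
  ∃ T T' : M.Tri, T ≠ T' ∧ e.1 ⊆ T.1 ∧ e.1 ⊆ T'.1

/-- The active boundary edges: the boundary edges contained in the Dirichlet part `ΓD`. -/
def activeBoundary (ΓD : Set Plane) : Finset M.Edge :=
  {e | ¬ M.IsInterior e ∧ edgeSet e.1 ⊆ ΓD}

/-- The active edges (the skeleton): internal edges and active boundary edges. -/
def activeEdges (ΓD : Set Plane) : Finset M.Edge :=
  {e | M.IsInterior e ∨ e ∈ M.activeBoundary ΓD}

/-- A choice of one of the two normals on each internal edge, that is, of which of the two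
adjacent triangles is on the minus side. On a boundary edge `minus e` is the unique adjacent
triangle and `plus e` is not used. -/
structure Orientation where
  minus : M.Edge → M.Tri
  plus : M.Edge → M.Tri
  subset_minus : ∀ e, e.1 ⊆ (minus e).1
  subset_plus : ∀ e, e.1 ⊆ (plus e).1
  minus_ne_plus : ∀ e, M.IsInterior e → minus e ≠ plus e

/-- Shape regularity with constant `σ`: every triangle `T` contains a disc of diameter
`h_T / σ`, where `h_T = diam T`. -/
def IsShapeRegular (σ : ℝ) : Prop :=
  ∀ T : M.Tri, ∃ c : Plane,
    Metric.closedBall c (Metric.diam (cell T.1) / (2 * σ)) ⊆ cell T.1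

/-- `h` is a mesh-size function on the edges, comparable with constant `κ` to the diameters of
the adjacent triangles. -/
def IsMeshSize (κ : ℝ) (h : M.Edge → ℝ) : Prop :=
  ∀ (e : M.Edge) (T : M.Tri), e.1 ⊆ T.1 →
    κ⁻¹ * Metric.diam (cell T.1) ≤ h e ∧ h e ≤ κ * Metric.diam (cell T.1)

/-- `V_h`: the discontinuous piecewise polynomial vector fields with three components, of total
degree at most two on each triangle. -/
abbrev DGSpace : Type :=
  M.Tri → Fin 3 → MvPolynomial.restrictTotalDegree (Fin 2) ℝ 2

variable {M}

/-- The value at `x` of the polynomial field that `y` has on `T`. -/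
def value (y : M.DGSpace) (x : Plane) (T : M.Tri) : Fin 3 → ℝ :=
  fun i => MvPolynomial.eval x.ofLp (y T i : MvPolynomial (Fin 2) ℝ)

/-- The gradient (Jacobian matrix) at `x` of the polynomial field that `y` has on `T`. -/
def grad (y : M.DGSpace) (x : Plane) (T : M.Tri) : Matrix (Fin 3) (Fin 2) ℝ :=
  Matrix.of fun i j =>
    MvPolynomial.eval x.ofLp (MvPolynomial.pderiv j (y T i : MvPolynomial (Fin 2) ℝ))

/-- The Hessian at `x` (one `2 × 2` matrix per component) of the polynomial field that `y` has
on `T`. -/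
def hess (y : M.DGSpace) (x : Plane) (T : M.Tri) : Fin 3 → Matrix (Fin 2) (Fin 2) ℝ :=
  fun i => Matrix.of fun j k => MvPolynomial.eval x.ofLp
    (MvPolynomial.pderiv k (MvPolynomial.pderiv j (y T i : MvPolynomial (Fin 2) ℝ)))

/-- Frobenius product of two Hessians. -/
def frobenius (A B : Fin 3 → Matrix (Fin 2) (Fin 2) ℝ) : ℝ :=
  ∑ i, ∑ j, ∑ k, A i j k * B i j k

namespace Orientation

variable (O : M.Orientation)

/-- The normal `n_e`, pointing from the minus side to the plus side on an internal edge and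
outward on a boundary edge. -/
def normal (e : M.Edge) : Plane := outwardNormal (O.minus e).1 e.1

/-- The jump over `e` of a quantity given triangle by triangle: minus side less plus side on
internal edges, the trace on boundary edges. -/
def jump {X : Type*} [AddCommGroup X] (q : M.Tri → X) (e : M.Edge) : X :=
  if M.IsInterior e then q (O.minus e) - q (O.plus e) else q (O.minus e)

/-- The average over `e` of a quantity given triangle by triangle; the trace on boundary edges. -/
def average {X : Type*} [AddCommGroup X] [Module ℝ X] (q : M.Tri → X) (e : M.Edge) : X :=
  if M.IsInterior e then (1 / 2 : ℝ) • (q (O.minus e) + q (O.plus e)) else q (O.minus e)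

/-- `[y]_e`. -/
def jumpValue (y : M.DGSpace) (e : M.Edge) (x : Plane) : Fin 3 → ℝ :=
  O.jump (value y x) e

/-- `[∇y]_e`, the jump of the gradient applied to the normal `n_e`. -/
def jumpGrad (y : M.DGSpace) (e : M.Edge) (x : Plane) : Fin 3 → ℝ :=
  O.jump (grad y x) e *ᵥ (O.normal e).ofLp

/-- `({∇²y}_e n_e) n_e`. -/
def averageHess (y : M.DGSpace) (e : M.Edge) (x : Plane) : Fin 3 → ℝ :=
  fun i => (O.average (hess y x) e i *ᵥ (O.normal e).ofLp) ⬝ᵥ (O.normal e).ofLp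

/-- The interior penalty bilinear form `a_h`. -/
def bilinearForm (ΓD : Set Plane) (h : M.Edge → ℝ) (η₀ η₁ : ℝ) (y w : M.DGSpace) : ℝ :=
  (∑ T : M.Tri, ∫ x in cell T.1, frobenius (hess y x T) (hess w x T))
    - (∑ e ∈ M.activeEdges ΓD,
        ∫ x in edgeSet e.1, O.jumpGrad y e x ⬝ᵥ O.averageHess w e x ∂lengthMeasure)
    - (∑ e ∈ M.activeEdges ΓD,
        ∫ x in edgeSet e.1, O.jumpGrad w e x ⬝ᵥ O.averageHess y e x ∂lengthMeasure)
    + η₁ * (∑ e ∈ M.activeEdges ΓD,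
        ∫ x in edgeSet e.1, (h e)⁻¹ * (O.jumpGrad y e x ⬝ᵥ O.jumpGrad w e x) ∂lengthMeasure)
    + η₀ * (∑ e ∈ M.activeEdges ΓD,
        ∫ x in edgeSet e.1,
          ((h e) ^ 3)⁻¹ * (O.jumpValue y e x ⬝ᵥ O.jumpValue w e x) ∂lengthMeasure)

/-- The linear form `F_h` that carries the Dirichlet data `yD` and `GD` (on boundary edges jumps
are traces). -/
def boundaryForm (ΓD : Set Plane) (h : M.Edge → ℝ) (η₀ η₁ : ℝ) (yD GD : Plane → Space)
    (w : M.DGSpace) : ℝ :=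
  - (∑ e ∈ M.activeBoundary ΓD,
        ∫ x in edgeSet e.1, (GD x).ofLp ⬝ᵥ O.averageHess w e x ∂lengthMeasure)
    + η₁ * (∑ e ∈ M.activeBoundary ΓD,
        ∫ x in edgeSet e.1, (h e)⁻¹ * ((GD x).ofLp ⬝ᵥ O.jumpGrad w e x) ∂lengthMeasure)
    + η₀ * (∑ e ∈ M.activeBoundary ΓD,
        ∫ x in edgeSet e.1,
          ((h e) ^ 3)⁻¹ * ((yD x).ofLp ⬝ᵥ O.jumpValue w e x) ∂lengthMeasure)

end Orientation

/-- The `L²(Ω)` pairing `(f, y)` of a force with a piecewise polynomial field. -/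
def load (f : Plane → Space) (y : M.DGSpace) : ℝ :=
  ∑ T : M.Tri, ∫ x in Ω ∩ cell T.1, (f x).ofLp ⬝ᵥ value y x T

/-- The discrete energy `E_h`. -/
def energy (O : M.Orientation) (ΓD : Set Plane) (h : M.Edge → ℝ) (η₀ η₁ : ℝ)
    (f yD GD : Plane → Space) (y : M.DGSpace) : ℝ :=
  1 / 2 * O.bilinearForm ΓD h η₀ η₁ y y - load f y - O.boundaryForm ΓD h η₀ η₁ yD GD y

variable (M) in
/-- The discrete admissible set `𝔸_h`: the gradient at the barycenter of each triangle lies in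
`St(3,2)`. -/
def admissible : Set M.DGSpace :=
  {w | ∀ T : M.Tri, grad w (barycenter T.1) T ∈ stiefel 3 2}

end Triangulation

end PlateDG

end

/-!
The unknown ranges over the finite-dimensional space `V_h`, and the energy is
`y ↦ ½ a_h(y, y) - l(y)` with `a_h` bilinear and `l` linear. The set `𝔸_h` is the preimage of a
closed set of matrices under the linear map `y ↦ (∇_h y(x_T))_T`. If `a_h` is positive definite,
the energy is continuous and coercive in any coordinates of `V_h`, and a minimizer exists
(`exists_isMinOn_quadratic`). Everything rests on the positivity of `a_h`
(`bilinearForm_self_pos`), with `ηmin = 12 C` and `C = 4 κ σ² / π`.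

*Lower bound* (`le_bilinearForm_self`). Hessians are constant on each triangle, so the inverse trace
estimate is elementary: `h_e |e| ≤ κ h_T² ≤ C |T|`, because `T` contains a disc of radius
`h_T / 2σ`. Young's inequality on each edge absorbs half of the gradient penalty, and since a
triangle has at most three edges, the remainder is at most `6 C / η₁ ≤ ½` times the volume term.
Hence `a_h(y, y)` dominates `½ ‖∇_h² y‖²` plus positive multiples of the two penalty terms.

*Null vectors* (`eq_zero_of_jump_eq_zero`). If all these terms vanish, `y` is affine on each
triangle, its jump vanishes at two distinct points of every active edge, and so does the normal
component of the jump of its gradient. The jump of the gradient then vanishes in two independent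
directions, so the affine fields on the two sides coincide; on an active boundary edge the affine
field is zero. The zero field spreads from there to all triangles
(`forall_of_edge_connected`): `Ω` minus the finitely many vertices is still connected, while two
families of triangles without a common edge could meet only in vertices. At most two triangles
contain a given edge (`eq_or_eq_of_edge_subset`), so these are the two that enter the jump.
-/

/-! ### Minimization of quadratic functionals -/

namespace PlateDG

theorem exists_isMinOn_quadratic_of_isClosed {E : Type*} [NormedAddCommGroup E] [NormedSpace ℝ E]
    [FiniteDimensional ℝ E] (B : E →ₗ[ℝ] E →ₗ[ℝ] ℝ) (hB : ∀ v, v ≠ 0 → 0 < B v v)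
    (l : E →ₗ[ℝ] ℝ) {K : Set E} (hK : IsClosed K) (hne : K.Nonempty) :
    ∃ v ∈ K, IsMinOn (fun w => 1 / 2 * B w w - l w) K v := by
  have : ProperSpace E := FiniteDimensional.proper ℝ E
  have hq : Continuous fun x : E => B x x := by
    have h := ((LinearMap.toContinuousLinearMap.toLinearMap ∘ₗ
      B).continuous_of_finiteDimensional).clm_apply continuous_id
    simpa using h
  have hl : Continuous l := l.continuous_of_finiteDimensional
  -- The constant `c` is the minimum of the form on the unit sphere, if there is a unit vector.
  obtain ⟨c, hc, hcB⟩ : ∃ c > 0, ∀ x : E, c * ‖x‖ ^ 2 ≤ B x x := by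
    have hmem : ∀ x : E, x ≠ 0 → ‖x‖⁻¹ • x ∈ Metric.sphere (0 : E) 1 := fun x hx => by
      simp [norm_smul, hx]
    rcases (Metric.sphere (0 : E) 1).eq_empty_or_nonempty with h0 | h0
    · refine ⟨1, one_pos, fun x => ?_⟩
      have : x = 0 := by
        by_contra hx
        simpa [h0] using hmem x hx
      simp [this]
    · obtain ⟨u, hu, hmin⟩ := (isCompact_sphere (0 : E) 1).exists_isMinOn h0 hq.continuousOn
      have hu0 : u ≠ 0 := by
        rintro rfl
        simp at hu
      refine ⟨B u u, hB _ hu0, fun x => ?_⟩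
      rcases eq_or_ne x 0 with rfl | hx
      · simp
      have h1 := hmin (hmem x hx)
      have hx' : 0 < ‖x‖ := norm_pos_iff.2 hx
      simp only [Set.mem_ofPred_eq, map_smul, LinearMap.smul_apply, smul_eq_mul] at h1
      calc B u u * ‖x‖ ^ 2 ≤ (‖x‖⁻¹ * (‖x‖⁻¹ * B x x)) * ‖x‖ ^ 2 := by gcongr
        _ = B x x := by field_simp
  let lc := LinearMap.toContinuousLinearMap l
  have hlb : ∀ x : E, l x ≤ ‖lc‖ * ‖x‖ := fun x => (le_abs_self _).trans (lc.le_opNorm x)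
  have hcoer : Filter.Tendsto (fun w => 1 / 2 * B w w - l w) (Filter.cocompact E)
      Filter.atTop := by
    have h1 : Filter.Tendsto (fun r : ℝ => r * (c / 2 * r - ‖lc‖)) Filter.atTop Filter.atTop :=
      Filter.tendsto_id.atTop_mul_atTop₀ (Filter.tendsto_atTop_add_const_right _ _
        (Filter.tendsto_id.const_mul_atTop (by positivity)))
    refine Filter.tendsto_atTop_mono (fun x => ?_) (h1.comp (tendsto_norm_cocompact_atTop (E := E)))
    have := hcB x
    have := hlb x
    simp only [Function.comp]
    nlinarith
  obtain ⟨v0, hv0⟩ := hne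
  exact ((continuous_const.mul hq).sub hl).continuousOn.exists_isMinOn' hK hv0
    ((hcoer.eventually_ge_atTop _).filter_mono inf_le_left)

/-- A positive definite quadratic form plus a linear functional attains its minimum on the preimage
of a closed set under a linear map. The space carries no topology; the proof passes to
coordinates. -/
theorem exists_isMinOn_quadratic {V W : Type*} [AddCommGroup V] [Module ℝ V]
    [FiniteDimensional ℝ V] [AddCommGroup W] [Module ℝ W] [TopologicalSpace W]
    [IsTopologicalAddGroup W] [ContinuousSMul ℝ W] (B : V →ₗ[ℝ] V →ₗ[ℝ] ℝ)
    (hB : ∀ v, v ≠ 0 → 0 < B v v) (l : V →ₗ[ℝ] ℝ) (L : V →ₗ[ℝ] W) {C : Set W}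
    (hC : IsClosed C) (hne : (L ⁻¹' C).Nonempty) :
    ∃ v ∈ L ⁻¹' C, IsMinOn (fun w => 1 / 2 * B w w - l w) (L ⁻¹' C) v := by
  let b := (Module.finBasis ℝ V).equivFun.symm
  have hL : Continuous (L ∘ₗ b.toLinearMap) := LinearMap.continuous_of_finiteDimensional _
  obtain ⟨v0, hv0⟩ := hne
  obtain ⟨x, hx, hmin⟩ := exists_isMinOn_quadratic_of_isClosed
    (B.compl₁₂ b.toLinearMap b.toLinearMap) (fun v hv => hB _ (by simpa using hv))
    (l ∘ₗ b.toLinearMap) (hC.preimage hL) ⟨b.symm v0, by simpa using hv0⟩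
  refine ⟨b x, hx, fun w hw => ?_⟩
  simpa using hmin (a := b.symm w) (by simpa using hw)

/-! ### Connectedness after removal of countably many points -/

theorem isPreconnected_ball_diff_countable {E : Type*} [NormedAddCommGroup E]
    [InnerProductSpace ℝ E] (hE : 1 < Module.rank ℝ E) (x : E) {r : ℝ} (hr : 0 < r) {s : Set E}
    (hs : s.Countable) : IsPreconnected (Metric.ball x r \ s) := by
  let φ := OpenPartialHomeomorph.univBall x r
  have hinj : Function.Injective φ := by
    have := φ.injOn
    rwa [OpenPartialHomeomorph.univBall_source, Set.injOn_univ] at this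
  have himg : φ '' (φ ⁻¹' s)ᶜ = Metric.ball x r \ s := by
    rw [← Set.preimage_compl, Set.image_preimage_eq_inter_range, Set.inter_comm]
    have : Set.range φ = Metric.ball x r := by
      rw [← Set.image_univ, ← OpenPartialHomeomorph.univBall_source x r,
        φ.image_source_eq_target, OpenPartialHomeomorph.univBall_target x hr]
    rw [this]; rfl
  rw [← himg]
  exact ((hs.preimage hinj).isConnected_compl_of_one_lt_rank hE).isPreconnected.image _
    (OpenPartialHomeomorph.continuous_univBall x r).continuousOn

/-- A connected open set stays connected in the absence of countably many points: if two closed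
sets cover it and meet inside it only in `s`, one of them contains all of it outside `s`. -/
theorem diff_subset_or_of_isPreconnected {E : Type*} [NormedAddCommGroup E]
    [InnerProductSpace ℝ E] (hE : 1 < Module.rank ℝ E) {Ω A B s : Set E} (hΩ : IsOpen Ω)
    (hconn : IsPreconnected Ω) (hA : IsClosed A) (hB : IsClosed B) (hs : s.Countable)
    (hcover : Ω ⊆ A ∪ B) (hinter : Ω ∩ (A ∩ B) ⊆ s) : Ω \ s ⊆ A ∨ Ω \ s ⊆ B := by
  have : Nontrivial E := rank_pos_iff_nontrivial.1 (zero_lt_one.trans hE)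
  have hdense : Dense sᶜ := hs.dense_compl ℝ
  have hdisj : Disjoint (Ω ∩ interior (A ∪ s)) (Ω ∩ interior (B ∪ s)) := by
    rw [Set.disjoint_iff_inter_eq_empty]
    by_contra hne
    obtain ⟨x, ⟨⟨hxΩ, hxA⟩, -, hxB⟩, hxs⟩ := hdense.inter_open_nonempty _
      ((hΩ.inter isOpen_interior).inter (hΩ.inter isOpen_interior))
      (Set.nonempty_iff_ne_empty.2 hne)
    have h1 := interior_subset hxA
    have h2 := interior_subset hxB
    exact hxs (hinter ⟨hxΩ, h1.resolve_right hxs, h2.resolve_right hxs⟩)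
  have hcov : Ω ⊆ (Ω ∩ interior (A ∪ s)) ∪ (Ω ∩ interior (B ∪ s)) := by
    intro x hx
    obtain ⟨r, hr, hball⟩ := Metric.isOpen_iff.1 hΩ x hx
    have key : ∀ D : Set E, Metric.ball x r \ s ⊆ D → x ∈ Ω ∩ interior (D ∪ s) := fun D hD =>
      ⟨hx, interior_mono (Set.sdiff_subset_iff.1 hD |>.trans_eq (Set.union_comm _ _))
        (by rw [Metric.isOpen_ball.interior_eq]; exact Metric.mem_ball_self hr)⟩
    have hsub : Metric.ball x r \ s ⊆ A ∪ B := (Set.sdiff_subset.trans hball).trans hcover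
    by_cases hA' : Metric.ball x r \ s ⊆ A
    · exact .inl (key A hA')
    by_cases hB' : Metric.ball x r \ s ⊆ B
    · exact .inr (key B hB')
    obtain ⟨p, hp, hpA⟩ := Set.not_subset.1 hA'
    obtain ⟨q, hq, hqB⟩ := Set.not_subset.1 hB'
    obtain ⟨z, hz, hzAB⟩ := isPreconnected_closed_iff.1
      (isPreconnected_ball_diff_countable hE x hr hs) A B hA hB hsub
      ⟨q, hq, (hsub hq).resolve_right hqB⟩ ⟨p, hp, (hsub hp).resolve_left hpA⟩
    exact absurd (hinter ⟨hball hz.1, hzAB⟩) hz.2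
  rcases hconn.subset_or_subset (hΩ.inter isOpen_interior) (hΩ.inter isOpen_interior) hdisj hcov
    with h | h
  · exact .inl fun x hx => (interior_subset (h hx.1).2).resolve_right hx.2
  · exact .inr fun x hx => (interior_subset (h hx.1).2).resolve_right hx.2

/-! ### Quadratic polynomials in two variables -/

theorem eq_quadratic_of_totalDegree_le_two {p : MvPolynomial (Fin 2) ℝ} (hp : p.totalDegree ≤ 2) :
    ∃ a b c d e f : ℝ, p = MvPolynomial.C a + MvPolynomial.C b * MvPolynomial.X 0
      + MvPolynomial.C c * MvPolynomial.X 1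
      + MvPolynomial.C d * (MvPolynomial.X 0 * MvPolynomial.X 0)
      + MvPolynomial.C e * (MvPolynomial.X 0 * MvPolynomial.X 1)
      + MvPolynomial.C f * (MvPolynomial.X 1 * MvPolynomial.X 1) := by
  have hmem := (MvPolynomial.mem_restrictTotalDegree (Fin 2) 2 p).2 hp
  rw [MvPolynomial.restrictTotalDegree, MvPolynomial.restrictSupport_eq_span] at hmem
  clear hp
  induction hmem using Submodule.span_induction with
  | mem q hq =>
    obtain ⟨m, hm, rfl⟩ := hq
    have hm' : m 0 + m 1 ≤ 2 := by
      simpa [Finsupp.sum_fintype] using hm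
    have hmon : MvPolynomial.monomial m (1 : ℝ)
        = MvPolynomial.X 0 ^ m 0 * MvPolynomial.X 1 ^ m 1 := by
      rw [MvPolynomial.monomial_eq, Finsupp.prod_fintype _ _ (by simp)]
      simp
    simp only [hmon]
    have h0 : m 0 ≤ 2 := by omega
    have h1 : m 1 ≤ 2 := by omega
    interval_cases m 0 <;> interval_cases m 1 <;> first | omega | skip
    · exact ⟨1, 0, 0, 0, 0, 0, by simp⟩
    · exact ⟨0, 0, 1, 0, 0, 0, by simp⟩
    · exact ⟨0, 0, 0, 0, 0, 1, by simp [pow_two]⟩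
    · exact ⟨0, 1, 0, 0, 0, 0, by simp⟩
    · exact ⟨0, 0, 0, 0, 1, 0, by simp⟩
    · exact ⟨0, 0, 0, 1, 0, 0, by simp [pow_two]⟩
  | zero => exact ⟨0, 0, 0, 0, 0, 0, by simp⟩
  | add q r _ _ hq hr =>
    obtain ⟨a, b, c, d, e, f, rfl⟩ := hq
    obtain ⟨a', b', c', d', e', f', rfl⟩ := hr
    exact ⟨a + a', b + b', c + c', d + d', e + e', f + f', by simp only [map_add]; ring⟩
  | smul t q _ hq =>
    obtain ⟨a, b, c, d, e, f, rfl⟩ := hq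
    refine ⟨t * a, t * b, t * c, t * d, t * e, t * f, ?_⟩
    simp only [MvPolynomial.smul_eq_C_mul, map_mul]; ring

/-- The exact Taylor expansion of a polynomial of degree at most two in two variables, with those
of its first and second derivatives. -/
theorem taylor_of_totalDegree_le_two {p : MvPolynomial (Fin 2) ℝ} (hp : p.totalDegree ≤ 2)
    (x z : Fin 2 → ℝ) :
    MvPolynomial.eval x p = MvPolynomial.eval z p
        + ∑ j, MvPolynomial.eval z (MvPolynomial.pderiv j p) * (x j - z j)
        + 1 / 2 * ∑ j, ∑ k, MvPolynomial.eval z (MvPolynomial.pderiv k (MvPolynomial.pderiv j p))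
          * ((x j - z j) * (x k - z k)) ∧
    (∀ j, MvPolynomial.eval x (MvPolynomial.pderiv j p) =
      MvPolynomial.eval z (MvPolynomial.pderiv j p)
        + ∑ k, MvPolynomial.eval z (MvPolynomial.pderiv k (MvPolynomial.pderiv j p))
          * (x k - z k)) ∧
    ∀ j k, MvPolynomial.eval x (MvPolynomial.pderiv k (MvPolynomial.pderiv j p)) =
      MvPolynomial.eval z (MvPolynomial.pderiv k (MvPolynomial.pderiv j p)) := by
  obtain ⟨a, b, c, d, e, f, rfl⟩ := eq_quadratic_of_totalDegree_le_two hp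
  refine ⟨?_, fun j => ?_, fun j k => ?_⟩
  · simp [Fin.sum_univ_two, MvPolynomial.pderiv_X, Pi.single_apply, Derivation.leibniz]
    ring
  · fin_cases j <;> simp [Fin.sum_univ_two, MvPolynomial.pderiv_X, Pi.single_apply] <;> ring
  · fin_cases j <;> fin_cases k <;> simp [MvPolynomial.pderiv_X]

/-! ### Triangles and their edges -/


/-- The determinant of two vectors of the plane. For `a ≠ b`, the sign of
`cross (b - a) (c - a)` tells on which side of the line through `a` and `b` the point `c` lies. -/
def cross (u v : Plane) : ℝ := u 0 * v 1 - u 1 * v 0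

theorem collinear_of_cross_eq_zero {a b c : Plane} (h : cross (b - a) (c - a) = 0) (hab : a ≠ b) :
    Collinear ℝ ({a, b, c} : Set Plane) := by
  rw [collinear_iff_of_mem (p₀ := a) (by simp)]
  set t := b - a with ht
  have htne : t ≠ 0 := sub_ne_zero.2 hab.symm
  have hb : b = (1 : ℝ) • t + a := by simp [ht]
  have hpos : t 0 ^ 2 + t 1 ^ 2 ≠ 0 := by
    intro h0
    apply htne
    ext i
    fin_cases i <;> simp <;> nlinarith [sq_nonneg (t 0), sq_nonneg (t 1)]
  refine ⟨t, ?_⟩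
  rintro p (rfl | rfl | rfl)
  · exact ⟨0, by simp⟩
  · exact ⟨1, hb⟩
  · refine ⟨(t 0 * (p - a) 0 + t 1 * (p - a) 1) / (t 0 ^ 2 + t 1 ^ 2), ?_⟩
    rw [vadd_eq_add, ← sub_eq_iff_eq_add]
    unfold cross at h
    ext i
    fin_cases i <;> simp at h ⊢ <;> field_simp
    · linear_combination (-(t 1)) * h
    · linear_combination (t 0) * h

/-- A triangle with edge `{a, b}` has a third vertex, and this vertex is off the line through
`a` and `b`. -/
theorem exists_third_vertex {T e : Finset Plane} {a b : Plane}
    (hT : AffineIndependent ℝ ((↑) : T → Plane)) (hcard : T.card = 3) (he : e ⊆ T)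
    (hab : a ≠ b) (heq : e = {a, b}) :
    ∃ c, T = {a, b, c} ∧ cross (b - a) (c - a) ≠ 0 := by
  have hcard' : (T \ e).card = 1 := by
    rw [Finset.card_sdiff_of_subset he, hcard, heq, Finset.card_pair hab]
  obtain ⟨c, hc⟩ := Finset.card_eq_one.1 hcard'
  have hTeq : T = {a, b, c} := by
    rw [← Finset.union_sdiff_of_subset he, hc, heq]
    ext; simp
  refine ⟨c, hTeq, fun h0 => ?_⟩
  have hcol := collinear_of_cross_eq_zero h0 hab
  have h2 := hT.finrank_vectorSpan (n := 2) (by simp [hcard])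
  have hrange : Set.range ((↑) : T → Plane) = {a, b, c} := by
    rw [Subtype.range_coe_subtype]; ext; simp [hTeq]
  rw [hrange] at h2
  rw [collinear_iff_finrank_le_one, h2] at hcol
  omega

/-- The normal is orthogonal to the edge, and it is nonzero because the barycenter of a triangle
is not on the line through an edge. -/
theorem outwardNormal_spec {T e : Finset Plane} {a b c : Plane} (hab : a ≠ b) (heq : e = {a, b})
    (hTeq : T = {a, b, c}) (hc : cross (b - a) (c - a) ≠ 0) :
    outwardNormal T e 0 * (b - a) 0 + outwardNormal T e 1 * (b - a) 1 = 0 ∧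
      outwardNormal T e ≠ 0 := by
  have hspan : vectorSpan ℝ (e : Set Plane) = Submodule.span ℝ {b - a} := by
    rw [heq]; push_cast
    rw [vectorSpan_pair_rev]; rfl
  set v := barycenter e - barycenter T with hv
  have hac : a ≠ c := by rintro rfl; simp [cross] at hc
  have hbc : b ≠ c := by rintro rfl; simp [cross, mul_comm] at hc
  have hv' : v = (6⁻¹ : ℝ) • ((b - a) - (2 : ℝ) • (c - a)) := by
    rw [hv, barycenter, barycenter, hTeq, heq, Finset.card_pair hab,
      Finset.card_eq_three.2 ⟨a, b, c, hab, hac, hbc, rfl⟩, Finset.sum_pair hab,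
      Finset.sum_insert (by simp [hab, hac]), Finset.sum_pair hbc]
    push_cast
    module
  set d : Plane := (vectorSpan ℝ (e : Set Plane))ᗮ.starProjection v with hd
  have hdmem : d ∈ (vectorSpan ℝ (e : Set Plane))ᗮ := Submodule.starProjection_apply_mem _ _
  have horth : inner ℝ (b - a) d = 0 := by
    rw [Submodule.mem_orthogonal] at hdmem
    exact hdmem _ (by rw [hspan]; exact Submodule.mem_span_singleton_self _)
  have hd0 : d ≠ 0 := by
    intro h0
    have hmem : v ∈ (vectorSpan ℝ (e : Set Plane))ᗮᗮ :=
      (Submodule.starProjection_apply_eq_zero_iff _).1 h0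
    rw [Submodule.orthogonal_orthogonal, hspan, Submodule.mem_span_singleton] at hmem
    obtain ⟨r, hr⟩ := hmem
    rw [hv'] at hr
    have h0 := congrArg (fun w : Plane => w 0) hr
    have h1 := congrArg (fun w : Plane => w 1) hr
    apply hc
    simp [cross] at h0 h1 ⊢
    linear_combination (3 * (b 0 - a 0)) * h1 - (3 * (b 1 - a 1)) * h0
  have hN : outwardNormal T e = ‖d‖⁻¹ • d := rfl
  refine ⟨?_, ?_⟩
  · rw [hN]
    simp [PiLp.inner_apply, Fin.sum_univ_two] at horth ⊢
    linear_combination ‖d‖⁻¹ * horth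
  · rw [hN]
    exact smul_ne_zero (inv_ne_zero (norm_ne_zero_iff.2 hd0)) hd0

theorem outwardNormal_sq_le_one (T e : Finset Plane) :
    outwardNormal T e 0 ^ 2 + outwardNormal T e 1 ^ 2 ≤ 1 := by
  have h : ‖outwardNormal T e‖ ≤ 1 := by
    simp only [outwardNormal, norm_smul, norm_inv, norm_norm]
    exact inv_mul_le_one
  have h2 := EuclideanSpace.norm_sq_eq (outwardNormal T e)
  simp only [Fin.sum_univ_two, Real.norm_eq_abs, sq_abs] at h2
  rw [← h2]
  exact pow_le_one₀ (norm_nonneg _) h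

theorem lengthMeasure_edgeSet {e : Finset Plane} {a b : Plane} (heq : e = {a, b}) :
    lengthMeasure (edgeSet e) = edist a b := by
  have : NullSingletonClass lengthMeasure :=
    Measure.nullSingletonClass_hausdorff _ one_pos
  rw [edgeSet, measure_sdiff_null (e.finite_toSet.measure_zero _), heq]
  push_cast
  rw [convexHull_pair, hausdorffMeasure_segment]

theorem measurableSet_edgeSet (e : Finset Plane) : MeasurableSet (edgeSet e) :=
  (e.finite_toSet.isCompact_convexHull (𝕜 := ℝ)).measurableSet.diff e.measurableSet

theorem isCompact_cell (T : Finset Plane) : IsCompact (cell T) :=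
  T.finite_toSet.isCompact_convexHull (𝕜 := ℝ)

theorem lengthMeasure_edgeSet_lt_top {e : Finset Plane} (he : e.card = 2) :
    lengthMeasure (edgeSet e) < ⊤ := by
  obtain ⟨a, b, -, heq⟩ := Finset.card_eq_two.1 he
  rw [lengthMeasure_edgeSet heq]
  exact edist_lt_top a b

theorem lengthMeasure_real_edgeSet_le {e T : Finset Plane} (he : e.card = 2) (heT : e ⊆ T) :
    lengthMeasure.real (edgeSet e) ≤ Metric.diam (cell T) := by
  obtain ⟨a, b, -, heq⟩ := Finset.card_eq_two.1 he
  rw [Measure.real, lengthMeasure_edgeSet heq, edist_dist, ENNReal.toReal_ofReal dist_nonneg]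
  have hsub : (e : Set Plane) ⊆ cell T :=
    (Finset.coe_subset.2 heT).trans (subset_convexHull ℝ _)
  exact Metric.dist_le_diam_of_mem (isCompact_cell T).isBounded
    (hsub (by simp [heq])) (hsub (by simp [heq]))

theorem diam_cell_pos {T : Finset Plane} (hT : T.card = 3) : 0 < Metric.diam (cell T) := by
  obtain ⟨a, b, c, hab, -, -, heq⟩ := Finset.card_eq_three.1 hT
  refine (dist_pos.2 hab).trans_le (Metric.dist_le_diam_of_mem (isCompact_cell T).isBounded
    (subset_convexHull ℝ _ (by simp [heq])) (subset_convexHull ℝ _ (by simp [heq])))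

/-- A property that holds almost everywhere on an edge holds at two different points of it, as
length measure does not charge points. -/
theorem exists_ne_of_ae_edgeSet {e : Finset Plane} (he : e.card = 2) {P : Plane → Prop}
    (hP : ∀ᵐ x ∂lengthMeasure.restrict (edgeSet e), P x) :
    ∃ p ∈ edgeSet e, ∃ q ∈ edgeSet e, p ≠ q ∧ P p ∧ P q := by
  have : NullSingletonClass lengthMeasure :=
    Measure.nullSingletonClass_hausdorff _ one_pos
  obtain ⟨a, b, hab, heq⟩ := Finset.card_eq_two.1 he
  have hpos : lengthMeasure (edgeSet e) ≠ 0 := by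
    rw [lengthMeasure_edgeSet heq]; exact (edist_pos.2 hab).ne'
  have hne : (ae (lengthMeasure.restrict (edgeSet e))).NeBot :=
    ae_neBot.2 (by rwa [Ne, Measure.restrict_eq_zero])
  have hmem := ae_restrict_mem (μ := lengthMeasure) (measurableSet_edgeSet e)
  obtain ⟨p, hp, hPp⟩ := (hmem.and hP).exists
  have hnp : ∀ᵐ x ∂lengthMeasure.restrict (edgeSet e), x ≠ p :=
    ae_restrict_of_ae (compl_mem_ae_iff.2 (measure_singleton p))
  obtain ⟨q, ⟨hq, hPq⟩, hqp⟩ := ((hmem.and hP).and hnp).exists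
  exact ⟨p, hp, q, hq, hqp.symm, hPp, hPq⟩

theorem exists_smul_of_mem_edgeSet {a b p q : Plane} {e : Finset Plane} (heq : e = {a, b})
    (hp : p ∈ edgeSet e) (hq : q ∈ edgeSet e) : ∃ r : ℝ, q - p = r • (b - a) := by
  have h : ∀ x ∈ edgeSet e, ∃ r : ℝ, x = a + r • (b - a) := by
    rintro x ⟨hx, -⟩
    rw [heq] at hx
    push_cast at hx
    rw [convexHull_pair, segment_eq_image'] at hx
    obtain ⟨r, -, rfl⟩ := hx
    exact ⟨r, rfl⟩
  obtain ⟨r, rfl⟩ := h p hp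
  obtain ⟨s, rfl⟩ := h q hq
  exact ⟨s - r, by module⟩

/-- Two triangles on the same side of a common edge overlap outside that edge. -/
theorem exists_mem_cell_inter_of_same_side {a b c c' : Plane} 
    (h : 0 < cross (b - a) (c - a) * cross (b - a) (c' - a)) :
    ∃ p ∈ cell {a, b, c} ∩ cell {a, b, c'}, p ∉ convexHull ℝ ({a, b} : Set Plane) := by
  set D := cross (b - a) (c - a) with hD
  set D' := cross (b - a) (c' - a) with hD'
  have hD0 : D ≠ 0 := by rintro h0; simp [h0] at h
  have hD0' : D' ≠ 0 := by rintro h0; simp [h0] at h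
  set γ := D' / D with hγ
  have hγpos : 0 < γ := by
    have : γ = D * D' / D ^ 2 := by rw [hγ]; field_simp
    rw [this]; positivity
  set α := cross (c' - a) (c - a) / D with hα
  have hc' : c' - a = α • (b - a) + γ • (c - a) := by
    ext i
    rw [hα, hγ, hD', hD]
    have := hD ▸ hD0
    fin_cases i <;> simp <;> field_simp <;> simp [cross] <;> ring
  -- The common point is `(1 - ε) (a + b) / 2 + ε c'`; for this `ε` its barycentric coordinates
  -- with respect to `a`, `b` and `c` are nonnegative.
  set K := 1 + 2 * |α| + 2 * |1 - α - γ| with hK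
  have hKpos : 0 < K := by positivity
  set ε := K⁻¹ with hε
  have hεpos : 0 < ε := inv_pos.2 hKpos
  have hεK : ε * K = 1 := inv_mul_cancel₀ hKpos.ne'
  have hε1 : ε ≤ 1 := by nlinarith [abs_nonneg α, abs_nonneg (1 - α - γ)]
  have hw : ∀ (w0 w1 w2 : ℝ) (z : Plane), 0 ≤ w0 → 0 ≤ w1 → 0 ≤ w2 → w0 + w1 + w2 = 1 →
      w0 • a + w1 • b + w2 • z ∈ cell {a, b, z} := by
    intro w0 w1 w2 z h0 h1 h2 hs
    have hcv : Convex ℝ (cell {a, b, z}) := convex_convexHull ℝ _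
    have hm : ∀ x ∈ ({a, b, z} : Finset Plane), x ∈ cell {a, b, z} :=
      fun x hx => subset_convexHull ℝ _ (by exact_mod_cast hx)
    have := hcv.sum_mem (t := Finset.univ) (w := ![w0, w1, w2]) (z := ![a, b, z])
      (by intro i _; fin_cases i <;> simpa) (by simp [Fin.sum_univ_three, hs])
      (by intro i _; fin_cases i <;> exact hm _ (by simp))
    simpa [Fin.sum_univ_three] using this
  refine ⟨((1 - ε) / 2) • a + ((1 - ε) / 2) • b + ε • c', ⟨?_, ?_⟩, ?_⟩
  · have : ((1 - ε) / 2) • a + ((1 - ε) / 2) • b + ε • c' =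
        ((1 - ε) / 2 + ε * (1 - α - γ)) • a + ((1 - ε) / 2 + ε * α) • b + (ε * γ) • c := by
      rw [sub_eq_iff_eq_add] at hc'
      rw [hc']; module
    rw [this]
    have h1 := mul_le_mul_of_nonneg_left (neg_abs_le α) hεpos.le
    have h2 := mul_le_mul_of_nonneg_left (neg_abs_le (1 - α - γ)) hεpos.le
    have h3 : 0 ≤ ε * |α| := by positivity
    have h4 : 0 ≤ ε * |1 - α - γ| := by positivity
    rw [hK] at hεK
    exact hw _ _ _ _ (by nlinarith) (by nlinarith) (by positivity) (by ring)
  · exact hw _ _ _ _ (by linarith) (by linarith) hεpos.le (by ring)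
  -- The determinant with `b - a` vanishes on the edge, but is `ε D'` at the common point.
  · intro hmem
    rw [convexHull_pair, segment_eq_image'] at hmem
    obtain ⟨r, -, hr⟩ := hmem
    have h0 := congrArg (fun w : Plane => w 0) hr
    have h1 := congrArg (fun w : Plane => w 1) hr
    have : ε * D' = 0 := by
      rw [hD', cross]
      simp only [PiLp.add_apply, PiLp.smul_apply, PiLp.sub_apply, smul_eq_mul] at h0 h1 ⊢
      linear_combination (b 1 - a 1) * h0 - (b 0 - a 0) * h1
    exact (mul_ne_zero hεpos.ne' hD0') this

/-! ### Combinatorics and connectedness of the triangulation -/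


namespace Triangulation

variable {Ω : Set Plane} (M : Triangulation Ω)

theorem card_inter_le_two {T T' : M.Tri} (h : T ≠ T') : (T.1 ∩ T'.1).card ≤ 2 := by
  by_contra! hlt
  have h1 : T.1 ∩ T'.1 = T.1 := Finset.eq_of_subset_of_card_le Finset.inter_subset_left
    (by rw [T.2.2]; exact hlt)
  have h2 : T.1 ∩ T'.1 = T'.1 := Finset.eq_of_subset_of_card_le Finset.inter_subset_right
    (by rw [T'.2.2]; exact hlt)
  exact h (Subtype.ext (h1.symm.trans h2))

theorem cell_inter_cell_subset (T T' : M.Tri) :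
    cell T.1 ∩ cell T'.1 ⊆ convexHull ℝ ((T.1 ∩ T'.1 : Finset Plane) : Set Plane) := by
  rw [Finset.coe_inter]
  exact M.complex.inter_subset_convexHull T.2.1 T'.2.1

/-- Two different triangles with a common edge lie on opposite sides of it. -/
theorem cross_mul_cross_neg {T T' : M.Tri} (hne : T ≠ T') {a b c c' : Plane} (hab : a ≠ b)
    (hT : T.1 = {a, b, c}) (hT' : T'.1 = {a, b, c'}) (hc : cross (b - a) (c - a) ≠ 0)
    (hc' : cross (b - a) (c' - a) ≠ 0) :
    cross (b - a) (c - a) * cross (b - a) (c' - a) < 0 := by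
  refine lt_of_le_of_ne (not_lt.1 fun hpos => ?_) (mul_ne_zero hc hc')
  obtain ⟨p, hp, hpn⟩ := exists_mem_cell_inter_of_same_side hpos
  rw [← hT, ← hT'] at hp
  have hinter : T.1 ∩ T'.1 = {a, b} := by
    refine (Finset.eq_of_subset_of_card_le ?_ ?_).symm
    · rw [hT, hT']
      intro x; simp; tauto
    · rw [Finset.card_pair hab]
      exact M.card_inter_le_two hne
  have := M.cell_inter_cell_subset T T' hp
  rw [hinter] at this
  exact hpn (by simpa using this)

/-- At most two triangles contain a given edge, because an edge has only two sides. -/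
theorem eq_or_eq_of_edge_subset {e : M.Edge} {T₁ T₂ T₃ : M.Tri} (h₁ : e.1 ⊆ T₁.1)
    (h₂ : e.1 ⊆ T₂.1) (h₃ : e.1 ⊆ T₃.1) (hne : T₁ ≠ T₂) : T₃ = T₁ ∨ T₃ = T₂ := by
  obtain ⟨a, b, hab, he⟩ := Finset.card_eq_two.1 e.2.2
  obtain ⟨c₁, hT₁, hc₁⟩ := exists_third_vertex (M.complex.indep T₁.2.1) T₁.2.2 h₁ hab he
  obtain ⟨c₂, hT₂, hc₂⟩ := exists_third_vertex (M.complex.indep T₂.2.1) T₂.2.2 h₂ hab he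
  obtain ⟨c₃, hT₃, hc₃⟩ := exists_third_vertex (M.complex.indep T₃.2.1) T₃.2.2 h₃ hab he
  by_contra! h
  have h12 := M.cross_mul_cross_neg hne hab hT₁ hT₂ hc₁ hc₂
  have h13 := M.cross_mul_cross_neg h.1 hab hT₃ hT₁ hc₃ hc₁
  have h23 := M.cross_mul_cross_neg h.2 hab hT₃ hT₂ hc₃ hc₂
  have := mul_pos_of_neg_of_neg h13 h23
  nlinarith [mul_self_nonneg (cross (b - a) (c₃ - a))]

/-- The triangles are connected through internal edges: a property of triangles that holds for one
of them and passes across common edges holds for all. Otherwise the triangles with the property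
and those without it form two closed sets that cover `Ω` and meet only in vertices, although
each of them contains points of `Ω` that are not vertices. -/
theorem forall_of_edge_connected (hΩ : IsLipschitzDomain Ω)
    (hball : ∀ T : M.Tri, ∃ c r, 0 < r ∧ Metric.ball c r ⊆ cell T.1) {P : M.Tri → Prop}
    {T₀ : M.Tri} (h₀ : P T₀)
    (hstep : ∀ (e : M.Edge) (T T' : M.Tri), T ≠ T' → e.1 ⊆ T.1 → e.1 ⊆ T'.1 → P T → P T')
    (T : M.Tri) : P T := by
  by_contra hPT
  let A : Set Plane := ⋃ T ∈ {T : M.Tri | P T}, cell T.1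
  let B : Set Plane := ⋃ T ∈ {T : M.Tri | ¬ P T}, cell T.1
  let s : Set Plane := ⋃ T : M.Tri, (T.1 : Set Plane)
  have hA : IsClosed A :=
    (Set.toFinite _).isClosed_biUnion fun T _ => (isCompact_cell T.1).isClosed
  have hB : IsClosed B :=
    (Set.toFinite _).isClosed_biUnion fun T _ => (isCompact_cell T.1).isClosed
  have hs : s.Countable := Set.countable_iUnion fun T => T.1.countable_toSet
  have hcell : ∀ T : M.Tri, cell T.1 ⊆ closure Ω := fun T => by
    rw [← M.space_eq]
    exact M.complex.convexHull_subset_space T.2.1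
  have hcover : Ω ⊆ A ∪ B := by
    intro x hx
    have hx' : x ∈ M.complex.space := by rw [M.space_eq]; exact subset_closure hx
    obtain ⟨t, ht, hxt⟩ := Geometry.SimplicialComplex.mem_space_iff.1 hx'
    obtain ⟨T, hT, hcard, htT⟩ := M.pure t ht
    have hxT : x ∈ cell T := convexHull_mono (Finset.coe_subset.2 htT) hxt
    let T' : M.Tri := ⟨T, hT, hcard⟩
    by_cases hP : P T'
    · exact .inl (Set.mem_biUnion (x := T') hP hxT)
    · exact .inr (Set.mem_biUnion (x := T') hP hxT)
  -- A common point of the two families is a common vertex of two triangles.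
  have hinter : A ∩ B ⊆ s := by
    rintro x ⟨hxA, hxB⟩
    obtain ⟨T₁, hT₁, hx₁⟩ := Set.mem_iUnion₂.1 hxA
    obtain ⟨T₂, hT₂, hx₂⟩ := Set.mem_iUnion₂.1 hxB
    have hne : T₁ ≠ T₂ := fun h => hT₂ (h ▸ hT₁)
    have hx := M.cell_inter_cell_subset T₁ T₂ ⟨hx₁, hx₂⟩
    have hnonempty : (T₁.1 ∩ T₂.1).Nonempty := by
      have := convexHull_nonempty_iff.1 ⟨x, hx⟩
      exact_mod_cast this
    have hcard : (T₁.1 ∩ T₂.1).card ≠ 2 := fun h2 =>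
      hT₂ (hstep ⟨T₁.1 ∩ T₂.1, M.complex.down_closed T₁.2.1 Finset.inter_subset_left hnonempty, h2⟩
        T₁ T₂ hne Finset.inter_subset_left Finset.inter_subset_right hT₁)
    have hle := M.card_inter_le_two hne
    obtain ⟨v, hv⟩ : ∃ v, T₁.1 ∩ T₂.1 = {v} :=
      Finset.card_eq_one.1 (by have := hnonempty.card_pos; omega)
    rw [hv] at hx
    have hxv : x = v := by simpa using hx
    have : v ∈ T₁.1 ∩ T₂.1 := by rw [hv]; exact Finset.mem_singleton_self v
    exact Set.mem_iUnion.2 ⟨T₁, by rw [hxv]; exact (Finset.mem_inter.1 this).1⟩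
  -- A triangle contains a ball in `closure Ω`, hence a point of `Ω` that is not a vertex.
  have hmeet : ∀ T : M.Tri, ∃ x ∈ Ω \ s, x ∈ cell T.1 := fun T => by
    obtain ⟨c, r, hr, hcr⟩ := hball T
    have hne : (Metric.ball c r ∩ Ω).Nonempty :=
      mem_closure_iff.1 (hcell T (hcr (Metric.mem_ball_self hr))) _ Metric.isOpen_ball
        (Metric.mem_ball_self hr)
    obtain ⟨x, ⟨hx, hxΩ⟩, hxs⟩ := (hs.dense_compl ℝ).inter_open_nonempty _
      (Metric.isOpen_ball.inter hΩ.isOpen) hne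
    exact ⟨x, ⟨hxΩ, hxs⟩, hcr hx⟩
  have hrank : 1 < Module.rank ℝ Plane := by
    rw [← Module.finrank_eq_rank]
    simp
  rcases diff_subset_or_of_isPreconnected hrank hΩ.isOpen hΩ.isConnected.isPreconnected hA hB hs
    hcover (Set.inter_subset_right.trans hinter) with h | h
  · obtain ⟨x, hx, hxT⟩ := hmeet T
    exact hx.2 (hinter ⟨h hx, Set.mem_biUnion (x := T) hPT hxT⟩)
  · obtain ⟨x, hx, hxT⟩ := hmeet T₀
    exact hx.2 (hinter ⟨Set.mem_biUnion (x := T₀) h₀ hxT, h hx⟩)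

end Triangulation

/-! ### Linearity and continuity of the discrete forms -/


section Integrals

variable {V ι : Type*} [AddCommGroup V] [Module ℝ V] [Fintype ι] {μ : Measure Plane}
  {S K : Set Plane}

theorem integrableOn_of_continuous {g : Plane → ℝ} (hg : Continuous g) (hS : MeasurableSet S)
    (hK : IsCompact K) (hSK : S ⊆ K) (hμ : μ S < ⊤) : IntegrableOn g S μ := by
  simpa using IntegrableOn.mul_continuousOn_of_subset (g := fun _ => (1 : ℝ))
    (integrableOn_const hμ.ne) hg.continuousOn hS hK hSK

theorem integrableOn_dotProduct {g q : Plane → ι → ℝ} (hg : ∀ i, IntegrableOn (g · i) S μ)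
    (hq : Continuous q) (hS : MeasurableSet S) (hK : IsCompact K) (hSK : S ⊆ K) :
    IntegrableOn (fun x => g x ⬝ᵥ q x) S μ :=
  integrable_finsetSum _ fun i _ => (hg i).mul_continuousOn_of_subset
    ((continuous_apply i).comp hq).continuousOn hS hK hSK

theorem exists_linear_setIntegral {g : Plane → ι → ℝ} (hg : ∀ i, IntegrableOn (g · i) S μ)
    (q : V →ₗ[ℝ] Plane → ι → ℝ) (hq : ∀ v, Continuous (q v)) (hS : MeasurableSet S)
    (hK : IsCompact K) (hSK : S ⊆ K) :
    ∃ l : V →ₗ[ℝ] ℝ, ∀ v, l v = ∫ x in S, g x ⬝ᵥ q v x ∂μ := by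
  have hint : ∀ v, IntegrableOn (fun x => g x ⬝ᵥ q v x) S μ := fun v =>
    integrableOn_dotProduct hg (hq v) hS hK hSK
  refine ⟨{ toFun := fun v => ∫ x in S, g x ⬝ᵥ q v x ∂μ, map_add' := ?_, map_smul' := ?_ },
    fun v => rfl⟩
  · intro v w
    simp only [map_add, Pi.add_apply, dotProduct_add]
    exact integral_add (hint v) (hint w)
  · intro r v
    simp only [map_smul, Pi.smul_apply, dotProduct_smul, RingHom.id_apply]
    exact integral_smul _ _

theorem exists_bilinear_setIntegral (p q : V →ₗ[ℝ] Plane → ι → ℝ) (hp : ∀ v, Continuous (p v))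
    (hq : ∀ v, Continuous (q v)) (hS : MeasurableSet S) (hK : IsCompact K) (hSK : S ⊆ K)
    (hμ : μ S < ⊤) :
    ∃ B : V →ₗ[ℝ] V →ₗ[ℝ] ℝ, ∀ v w, B v w = ∫ x in S, p v x ⬝ᵥ q w x ∂μ := by
  have hint : ∀ v w, IntegrableOn (fun x => p v x ⬝ᵥ q w x) S μ := fun v w =>
    integrableOn_dotProduct
      (fun i => integrableOn_of_continuous ((continuous_apply i).comp (hp v)) hS hK hSK hμ)
      (hq w) hS hK hSK
  refine ⟨LinearMap.mk₂ ℝ (fun v w => ∫ x in S, p v x ⬝ᵥ q w x ∂μ) ?_ ?_ ?_ ?_, fun v w => rfl⟩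
  · intro v v' w
    simp only [map_add, Pi.add_apply, add_dotProduct]
    exact integral_add (hint v w) (hint v' w)
  · intro r v w
    simp only [map_smul, Pi.smul_apply, smul_dotProduct]
    exact integral_smul _ _
  · intro v w w'
    simp only [map_add, Pi.add_apply, dotProduct_add]
    exact integral_add (hint v w) (hint v w')
  · intro r v w
    simp only [map_smul, Pi.smul_apply, dotProduct_smul]
    exact integral_smul _ _

end Integrals

namespace Triangulation

variable {Ω : Set Plane} {M : Triangulation Ω}

theorem value_add (y w : M.DGSpace) (x : Plane) : value (y + w) x = value y x + value w x := by
  ext T i; simp [value]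

theorem value_smul (r : ℝ) (y : M.DGSpace) (x : Plane) : value (r • y) x = r • value y x := by
  ext T i; simp [value]

theorem grad_add (y w : M.DGSpace) (x : Plane) : grad (y + w) x = grad y x + grad w x := by
  ext T i j; simp [grad]

theorem grad_smul (r : ℝ) (y : M.DGSpace) (x : Plane) : grad (r • y) x = r • grad y x := by
  ext T i j; simp [grad]

theorem hess_add (y w : M.DGSpace) (x : Plane) : hess (y + w) x = hess y x + hess w x := by
  ext T i j k; simp [hess]

theorem hess_smul (r : ℝ) (y : M.DGSpace) (x : Plane) : hess (r • y) x = r • hess y x := by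
  ext T i j k; simp [hess]

theorem continuous_value (y : M.DGSpace) : Continuous (value y) := by
  refine continuous_pi fun T => continuous_pi fun i => ?_
  exact (MvPolynomial.continuous_eval _).comp (PiLp.continuous_ofLp 2 _)

theorem continuous_grad (y : M.DGSpace) : Continuous (grad y) := by
  refine continuous_pi fun T => continuous_pi fun i => continuous_pi fun j => ?_
  exact (MvPolynomial.continuous_eval _).comp (PiLp.continuous_ofLp 2 _)

theorem continuous_hess (y : M.DGSpace) : Continuous (hess y) := by
  refine continuous_pi fun T => continuous_pi fun i => continuous_pi fun j =>
    continuous_pi fun k => ?_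
  exact (MvPolynomial.continuous_eval _).comp (PiLp.continuous_ofLp 2 _)

namespace Orientation

variable (O : M.Orientation)

theorem jump_add {X : Type*} [AddCommGroup X] (p q : M.Tri → X) (e : M.Edge) :
    O.jump (p + q) e = O.jump p e + O.jump q e := by
  unfold jump; split_ifs <;> simp; abel

theorem jump_smul {X : Type*} [AddCommGroup X] [Module ℝ X] (r : ℝ) (q : M.Tri → X)
    (e : M.Edge) : O.jump (r • q) e = r • O.jump q e := by
  unfold jump; split_ifs <;> simp [smul_sub]

theorem average_add {X : Type*} [AddCommGroup X] [Module ℝ X] (p q : M.Tri → X) (e : M.Edge) :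
    O.average (p + q) e = O.average p e + O.average q e := by
  unfold average; split_ifs <;> simp; abel

theorem average_smul {X : Type*} [AddCommGroup X] [Module ℝ X] (r : ℝ) (q : M.Tri → X)
    (e : M.Edge) : O.average (r • q) e = r • O.average q e := by
  unfold average; split_ifs
  · simp only [Pi.smul_apply, ← smul_add]; rw [smul_comm]
  · rfl

theorem continuous_jump {X : Type*} [AddCommGroup X] [TopologicalSpace X]
    [IsTopologicalAddGroup X] {q : Plane → M.Tri → X} (hq : Continuous q) (e : M.Edge) :
    Continuous fun x => O.jump (q x) e := by
  unfold jump; split_ifs <;> fun_prop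

theorem continuous_average {X : Type*} [AddCommGroup X] [Module ℝ X] [TopologicalSpace X]
    [IsTopologicalAddGroup X] [ContinuousSMul ℝ X] {q : Plane → M.Tri → X} (hq : Continuous q)
    (e : M.Edge) : Continuous fun x => O.average (q x) e := by
  unfold average; split_ifs <;> fun_prop

/-- The jump `[y]_e` as a linear map of `y`. -/
noncomputable def jumpValueₗ (e : M.Edge) : M.DGSpace →ₗ[ℝ] Plane → Fin 3 → ℝ where
  toFun y x := O.jumpValue y e x
  map_add' y w := by ext1 x; simp [jumpValue, value_add, jump_add]
  map_smul' r y := by ext1 x; simp [jumpValue, value_smul, jump_smul]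

/-- The normal component `[∇y]_e` of the jump of the gradient as a linear map of `y`. -/
noncomputable def jumpGradₗ (e : M.Edge) : M.DGSpace →ₗ[ℝ] Plane → Fin 3 → ℝ where
  toFun y x := O.jumpGrad y e x
  map_add' y w := by ext1 x; simp [jumpGrad, grad_add, jump_add, add_mulVec]
  map_smul' r y := by ext1 x; simp [jumpGrad, grad_smul, jump_smul, smul_mulVec]

/-- The normal-normal component of the averaged Hessian as a linear map of `y`. -/
noncomputable def averageHessₗ (e : M.Edge) : M.DGSpace →ₗ[ℝ] Plane → Fin 3 → ℝ where
  toFun y x := O.averageHess y e x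
  map_add' y w := by
    ext x i
    simp only [averageHess, hess_add, average_add, Pi.add_apply, add_mulVec, add_dotProduct]
  map_smul' r y := by
    ext x i
    simp only [averageHess, hess_smul, average_smul, Pi.smul_apply, smul_mulVec,
      smul_dotProduct, RingHom.id_apply]

theorem continuous_jumpValue (y : M.DGSpace) (e : M.Edge) : Continuous (O.jumpValue y e) :=
  O.continuous_jump (continuous_value y) e

theorem continuous_jumpGrad (y : M.DGSpace) (e : M.Edge) : Continuous (O.jumpGrad y e) :=
  (O.continuous_jump (continuous_grad y) e).matrix_mulVec continuous_const

theorem continuous_averageHess (y : M.DGSpace) (e : M.Edge) : Continuous (O.averageHess y e) :=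
  continuous_pi fun i => (((continuous_apply i).comp
    (O.continuous_average (continuous_hess y) e)).matrix_mulVec continuous_const).dotProduct
      continuous_const

end Orientation

theorem exists_bilinearForm_eq (O : M.Orientation) (ΓD : Set Plane) (h : M.Edge → ℝ)
    (η₀ η₁ : ℝ) :
    ∃ B : M.DGSpace →ₗ[ℝ] M.DGSpace →ₗ[ℝ] ℝ, ∀ y w, B y w = O.bilinearForm ΓD h η₀ η₁ y w := by
  have hedge : ∀ (e : M.Edge) (p q : M.DGSpace →ₗ[ℝ] Plane → Fin 3 → ℝ),
      (∀ v, Continuous (p v)) → (∀ v, Continuous (q v)) →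
      ∃ B : M.DGSpace →ₗ[ℝ] M.DGSpace →ₗ[ℝ] ℝ,
        ∀ v w, B v w = ∫ x in edgeSet e.1, p v x ⬝ᵥ q w x ∂lengthMeasure :=
    fun e p q hp hq => exists_bilinear_setIntegral p q hp hq (measurableSet_edgeSet e.1)
      (isCompact_cell e.1) Set.sdiff_subset (lengthMeasure_edgeSet_lt_top e.2.2)
  have hvol : ∀ T : M.Tri, ∃ B : M.DGSpace →ₗ[ℝ] M.DGSpace →ₗ[ℝ] ℝ,
      ∀ y w, B y w = ∫ x in cell T.1, frobenius (hess y x T) (hess w x T) := by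
    intro T
    let q : M.DGSpace →ₗ[ℝ] Plane → Fin 3 × Fin 2 × Fin 2 → ℝ :=
      { toFun := fun y x k => hess y x T k.1 k.2.1 k.2.2
        map_add' := fun y w => by ext x k; simp [hess_add]
        map_smul' := fun r y => by ext x k; simp [hess_smul] }
    have hq : ∀ y, Continuous (q y) := fun y => continuous_pi fun k => by
      have := continuous_hess y
      exact (continuous_apply_apply k.2.1 k.2.2).comp
        ((continuous_apply_apply T k.1).comp this)
    obtain ⟨B, hB⟩ := exists_bilinear_setIntegral (μ := volume) q q hq hq
      (isCompact_cell T.1).measurableSet (isCompact_cell T.1) subset_rfl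
      (isCompact_cell T.1).measure_lt_top
    refine ⟨B, fun y w => ?_⟩
    rw [hB]
    simp [q, frobenius, dotProduct, Fintype.sum_prod_type]
  choose BT hBT using hvol
  choose B1 hB1 using fun e => hedge e (O.jumpGradₗ e) (O.averageHessₗ e)
    (fun v => O.continuous_jumpGrad v e) (fun v => O.continuous_averageHess v e)
  choose B2 hB2 using fun e => hedge e (O.jumpGradₗ e) (O.jumpGradₗ e)
    (fun v => O.continuous_jumpGrad v e) (fun v => O.continuous_jumpGrad v e)
  choose B3 hB3 using fun e => hedge e (O.jumpValueₗ e) (O.jumpValueₗ e)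
    (fun v => O.continuous_jumpValue v e) (fun v => O.continuous_jumpValue v e)
  refine ⟨∑ T, BT T - ∑ e ∈ M.activeEdges ΓD, B1 e - ∑ e ∈ M.activeEdges ΓD, (B1 e).flip
    + η₁ • ∑ e ∈ M.activeEdges ΓD, (h e)⁻¹ • B2 e
    + η₀ • ∑ e ∈ M.activeEdges ΓD, ((h e) ^ 3)⁻¹ • B3 e, fun y w => ?_⟩
  simp only [LinearMap.add_apply, LinearMap.sub_apply, LinearMap.smul_apply,
    LinearMap.sum_apply, LinearMap.flip_apply, smul_eq_mul, hBT, hB1, hB2, hB3]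
  simp only [Orientation.bilinearForm, integral_const_mul]
  rfl

theorem integrableOn_of_memLp {f : Plane → Space} {μ : Measure Plane} {S S' : Set Plane}
    (hf : MemLp f 2 (μ.restrict S')) (hS : S ⊆ S') (hμ : μ S < ⊤) (i : Fin 3) :
    IntegrableOn (fun x => (f x).ofLp i) S μ := by
  have : IsFiniteMeasure (μ.restrict S) := ⟨by simpa using hμ⟩
  have h1 : Integrable f (μ.restrict S) :=
    (hf.mono_measure (Measure.restrict_mono_set _ hS)).integrable (by norm_num)
  exact ((EuclideanSpace.proj (𝕜 := ℝ) i).integrable_comp h1 :)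

/-- The load and the boundary form are linear in `y`. This uses that the data are square
integrable, so that all the integrals are those of integrable functions. -/
theorem exists_load_add_boundaryForm_eq (O : M.Orientation) (hΩ : IsOpen Ω) {ΓD : Set Plane}
    (h : M.Edge → ℝ) (η₀ η₁ : ℝ) {f yD GD : Plane → Space} (hf : MemLp f 2 (volume.restrict Ω))
    (hyD : MemLp yD 2 (lengthMeasure.restrict ΓD)) (hGD : MemLp GD 2 (lengthMeasure.restrict ΓD)) :
    ∃ l : M.DGSpace →ₗ[ℝ] ℝ, ∀ y, l y = load f y + O.boundaryForm ΓD h η₀ η₁ yD GD y := by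
  have hedge : ∀ (e : M.Edge) (g : Plane → Space), MemLp g 2 (lengthMeasure.restrict ΓD) →
      ∀ q : M.DGSpace →ₗ[ℝ] Plane → Fin 3 → ℝ, (∀ v, Continuous (q v)) →
      ∃ l : M.DGSpace →ₗ[ℝ] ℝ, e ∈ M.activeBoundary ΓD →
        ∀ v, l v = ∫ x in edgeSet e.1, (g x).ofLp ⬝ᵥ q v x ∂lengthMeasure := by
    intro e g hg q hq
    by_cases he : e ∈ M.activeBoundary ΓD
    · have hsub : edgeSet e.1 ⊆ ΓD := (by simpa [activeBoundary] using he :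
        ¬ M.IsInterior e ∧ edgeSet e.1 ⊆ ΓD).2
      obtain ⟨l, hl⟩ := exists_linear_setIntegral
        (integrableOn_of_memLp hg hsub (lengthMeasure_edgeSet_lt_top e.2.2)) q hq
        (measurableSet_edgeSet e.1) (isCompact_cell e.1) Set.sdiff_subset
      exact ⟨l, fun _ => hl⟩
    -- Off the Dirichlet part nothing is claimed, and any functional will do.
    · exact ⟨0, fun h => absurd h he⟩
  have hvol : ∀ T : M.Tri, ∃ l : M.DGSpace →ₗ[ℝ] ℝ,
      ∀ y, l y = ∫ x in Ω ∩ cell T.1, (f x).ofLp ⬝ᵥ value y x T := by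
    intro T
    let q : M.DGSpace →ₗ[ℝ] Plane → Fin 3 → ℝ :=
      { toFun := fun y x => value y x T
        map_add' := fun y w => by ext x k; simp [value_add]
        map_smul' := fun r y => by ext x k; simp [value_smul] }
    exact exists_linear_setIntegral
      (integrableOn_of_memLp hf Set.inter_subset_left
        ((measure_mono Set.inter_subset_right).trans_lt (isCompact_cell T.1).measure_lt_top)) q
      (fun y => (continuous_apply T).comp (continuous_value y))
      (hΩ.measurableSet.inter (isCompact_cell T.1).measurableSet) (isCompact_cell T.1)
      Set.inter_subset_right
  choose lT hlT using hvol
  choose l1 hl1 using fun e => hedge e GD hGD (O.averageHessₗ e) fun v =>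
    O.continuous_averageHess v e
  choose l2 hl2 using fun e => hedge e GD hGD (O.jumpGradₗ e) fun v => O.continuous_jumpGrad v e
  choose l3 hl3 using fun e => hedge e yD hyD (O.jumpValueₗ e) fun v => O.continuous_jumpValue v e
  refine ⟨∑ T, lT T + (-(∑ e ∈ M.activeBoundary ΓD, l1 e)
    + η₁ • ∑ e ∈ M.activeBoundary ΓD, (h e)⁻¹ • l2 e
    + η₀ • ∑ e ∈ M.activeBoundary ΓD, ((h e) ^ 3)⁻¹ • l3 e), fun y => ?_⟩
  simp only [LinearMap.add_apply, LinearMap.neg_apply, LinearMap.smul_apply,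
    LinearMap.sum_apply, smul_eq_mul, hlT, load, Orientation.boundaryForm, integral_const_mul]
  rw [Finset.sum_congr rfl fun e he => hl1 e he y,
    Finset.sum_congr rfl fun e he => congrArg ((h e)⁻¹ * ·) (hl2 e he y),
    Finset.sum_congr rfl fun e he => congrArg (((h e) ^ 3)⁻¹ * ·) (hl3 e he y)]
  rfl

theorem exists_grad_barycenter_eq (M : Triangulation Ω) :
    ∃ L : M.DGSpace →ₗ[ℝ] M.Tri → Matrix (Fin 3) (Fin 2) ℝ,
      ∀ y T, L y T = grad y (barycenter T.1) T :=
  ⟨{ toFun := fun y T => grad y (barycenter T.1) T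
     map_add' := fun y w => by ext1 T; rw [grad_add]; rfl
     map_smul' := fun r y => by ext1 T; rw [grad_smul]; rfl }, fun _ _ => rfl⟩

end Triangulation

/-! ### Lower bound for the bilinear form -/


theorem mulVec_dotProduct_sq_le (A : Matrix (Fin 2) (Fin 2) ℝ) {n : Fin 2 → ℝ}
    (hn : n 0 ^ 2 + n 1 ^ 2 ≤ 1) : ((A *ᵥ n) ⬝ᵥ n) ^ 2 ≤ ∑ j, ∑ k, A j k * A j k := by
  have h := Finset.sum_mul_sq_le_sq_mul_sq Finset.univ (fun p : Fin 2 × Fin 2 => A p.1 p.2)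
    (fun p => n p.1 * n p.2)
  simp only [Fintype.sum_prod_type, Fin.sum_univ_two] at h
  simp only [mulVec, dotProduct, Fin.sum_univ_two]
  set S := A 0 0 * A 0 0 + A 0 1 * A 0 1 + (A 1 0 * A 1 0 + A 1 1 * A 1 1) with hS
  have hS0 : 0 ≤ S := by
    have := mul_self_nonneg (A 0 0)
    have := mul_self_nonneg (A 0 1)
    have := mul_self_nonneg (A 1 0)
    have := mul_self_nonneg (A 1 1)
    linarith
  have h1 : (n 0 ^ 2 + n 1 ^ 2) ^ 2 ≤ 1 := pow_le_one₀ (by positivity) hn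
  calc _ = _ := by congr 1; ring
    _ ≤ _ := h
    _ = S * (n 0 ^ 2 + n 1 ^ 2) ^ 2 := by rw [hS]; ring
    _ ≤ S * 1 := by gcongr
    _ = S := mul_one S

/-- Young's inequality with parameter `t`. -/
theorem two_mul_dotProduct_le {ι : Type*} [Fintype ι] (u v : ι → ℝ) {t : ℝ} (ht : 0 < t) :
    2 * (u ⬝ᵥ v) ≤ t * (u ⬝ᵥ u) + t⁻¹ * (v ⬝ᵥ v) := by
  simp only [dotProduct, Finset.mul_sum, ← Finset.sum_add_distrib]
  refine Finset.sum_le_sum fun i _ => ?_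
  have h : 0 ≤ t⁻¹ * (t * u i - v i) ^ 2 := by positivity
  have h2 : t⁻¹ * (t * u i - v i) ^ 2 = t * (u i * u i) + t⁻¹ * (v i * v i) - 2 * (u i * v i) := by
    field_simp; ring
  linarith

theorem zero_le_dotProduct_self {ι : Type*} [Fintype ι] (u : ι → ℝ) : 0 ≤ u ⬝ᵥ u :=
  Finset.sum_nonneg fun i _ => mul_self_nonneg (u i)

/-- Shape regularity bounds the squared diameter by the area: compare the triangle with the disc
of radius `diam / (2 σ)` inside it. -/
theorem diam_sq_le_volume_cell {T : Finset Plane} {σ : ℝ} (hσ : 0 < σ) {c : Plane}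
    (hc : Metric.closedBall c (Metric.diam (cell T) / (2 * σ)) ⊆ cell T) :
    Metric.diam (cell T) ^ 2 ≤ 4 * σ ^ 2 / Real.pi * volume.real (cell T) := by
  have h1 : volume.real (Metric.closedBall c (Metric.diam (cell T) / (2 * σ)))
      ≤ volume.real (cell T) :=
    measureReal_mono hc (isCompact_cell T).measure_lt_top.ne
  have h2 : volume.real (Metric.closedBall c (Metric.diam (cell T) / (2 * σ)))
      = (Metric.diam (cell T) / (2 * σ)) ^ 2 * Real.pi := by
    rw [Measure.real, EuclideanSpace.volume_closedBall_fin_two]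
    have : 0 ≤ Metric.diam (cell T) / (2 * σ) := div_nonneg Metric.diam_nonneg (by positivity)
    simp [ENNReal.toReal_ofReal this, Real.pi_pos.le]
  rw [h2] at h1
  have hpi := Real.pi_pos
  calc Metric.diam (cell T) ^ 2
      = 4 * σ ^ 2 / Real.pi * ((Metric.diam (cell T) / (2 * σ)) ^ 2 * Real.pi) := by
        field_simp; ring
    _ ≤ _ := by gcongr

namespace Triangulation

variable {Ω : Set Plane} {M : Triangulation Ω}

theorem frobenius_self_nonneg (A : Fin 3 → Matrix (Fin 2) (Fin 2) ℝ) : 0 ≤ frobenius A A :=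
  Finset.sum_nonneg fun _ _ => Finset.sum_nonneg fun _ _ => Finset.sum_nonneg fun _ _ =>
    mul_self_nonneg _

theorem frobenius_self_eq_zero {A : Fin 3 → Matrix (Fin 2) (Fin 2) ℝ} (h : frobenius A A = 0) :
    A = 0 := by
  ext i j k
  have h0 : ∀ i j, 0 ≤ ∑ k, A i j k * A i j k := fun i j =>
    Finset.sum_nonneg fun _ _ => mul_self_nonneg _
  have h1 := (Finset.sum_eq_zero_iff_of_nonneg
    fun i _ => Finset.sum_nonneg fun j _ => h0 i j).1 h i (Finset.mem_univ _)
  have h2 := (Finset.sum_eq_zero_iff_of_nonneg fun j _ => h0 i j).1 h1 j (Finset.mem_univ _)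
  have h3 := (Finset.sum_eq_zero_iff_of_nonneg
    fun k _ => mul_self_nonneg _).1 h2 k (Finset.mem_univ _)
  exact mul_self_eq_zero.1 h3

theorem totalDegree_le_two (y : M.DGSpace) (T : M.Tri) (i : Fin 3) :
    (y T i : MvPolynomial (Fin 2) ℝ).totalDegree ≤ 2 :=
  (MvPolynomial.mem_restrictTotalDegree _ _ _).1 (y T i).2

theorem hess_eq (y : M.DGSpace) (x z : Plane) (T : M.Tri) : hess y x T = hess y z T := by
  ext i j k
  exact (taylor_of_totalDegree_le_two (totalDegree_le_two y T i) _ _).2.2 j k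

theorem value_eq_of_hess_eq_zero {y : M.DGSpace} {T : M.Tri} {z : Plane} (hz : hess y z T = 0)
    (x : Plane) : value y x T = value y z T + grad y z T *ᵥ (x - z).ofLp := by
  ext i
  have h := (taylor_of_totalDegree_le_two (totalDegree_le_two y T i) x.ofLp z.ofLp).1
  have hz' : ∀ j k, MvPolynomial.eval z.ofLp (MvPolynomial.pderiv k
      (MvPolynomial.pderiv j (y T i : MvPolynomial (Fin 2) ℝ))) = 0 := fun j k =>
    congrFun₂ (congrFun hz i) j k
  simpa [hz', value, grad, mulVec, dotProduct] using h

theorem eq_zero_of_value_eq_zero {y : M.DGSpace} (h : ∀ T x, value y x T = 0) : y = 0 := by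
  ext1 T
  ext1 i
  refine Subtype.ext (MvPolynomial.funext fun v => ?_)
  simpa [value] using congrFun (h T (WithLp.toLp 2 v)) i

/-- The average over an edge is controlled by the Hessians on the adjacent triangles, because the
normal has length at most one. -/
theorem averageHess_dotProduct_self_le (O : M.Orientation) (y : M.DGSpace) (e : M.Edge)
    (x : Plane) :
    O.averageHess y e x ⬝ᵥ O.averageHess y e x ≤
      ∑ T with e.1 ⊆ T.1, frobenius (hess y x T) (hess y x T) := by
  set n := (O.normal e).ofLp with hn
  have hn1 : n 0 ^ 2 + n 1 ^ 2 ≤ 1 := outwardNormal_sq_le_one _ _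
  have hsq : ∀ T : M.Tri, ∑ i, ((hess y x T i *ᵥ n) ⬝ᵥ n) ^ 2 ≤
      frobenius (hess y x T) (hess y x T) := fun T =>
    Finset.sum_le_sum fun i _ => mulVec_dotProduct_sq_le _ hn1
  have hnn : ∀ T ∈ Finset.univ.filter (fun T : M.Tri => e.1 ⊆ T.1),
      0 ≤ frobenius (hess y x T) (hess y x T) := fun T _ => frobenius_self_nonneg _
  have hm : O.minus e ∈ Finset.univ.filter (fun T : M.Tri => e.1 ⊆ T.1) := by
    simpa using O.subset_minus e
  have hp : O.plus e ∈ Finset.univ.filter (fun T : M.Tri => e.1 ⊆ T.1) := by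
    simpa using O.subset_plus e
  by_cases he : M.IsInterior e
  · have hsum := Finset.sum_le_sum_of_subset_of_nonneg
      (f := fun T => frobenius (hess y x T) (hess y x T))
      (Finset.insert_subset hm (Finset.singleton_subset_iff.2 hp)) fun T hT _ => hnn T hT
    rw [Finset.sum_pair (O.minus_ne_plus e he)] at hsum
    refine le_trans ?_ ((add_le_add (hsq _) (hsq _)).trans hsum)
    rw [← Finset.sum_add_distrib]
    refine Finset.sum_le_sum fun i _ => ?_
    have : O.averageHess y e x i = 1 / 2 * ((hess y x (O.minus e) i *ᵥ n) ⬝ᵥ n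
        + (hess y x (O.plus e) i *ᵥ n) ⬝ᵥ n) := by
      simp only [Orientation.averageHess, Orientation.average, if_pos he, Pi.smul_apply,
        Pi.add_apply, smul_mulVec, add_mulVec, smul_dotProduct, add_dotProduct, smul_eq_mul, ← hn]
    rw [this]
    set a := (hess y x (O.minus e) i *ᵥ n) ⬝ᵥ n
    set b := (hess y x (O.plus e) i *ᵥ n) ⬝ᵥ n
    nlinarith [sq_nonneg (a - b), sq_nonneg a, sq_nonneg b]
  · refine le_trans ?_ ((hsq _).trans (Finset.single_le_sum hnn hm))
    refine Finset.sum_le_sum fun i _ => ?_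
    simp only [Orientation.averageHess, Orientation.average, if_neg he, ← hn, ← pow_two]
    exact le_rfl

/-- Each triangle is counted at most three times in a sum over edges and their triangles. -/
theorem sum_edge_sum_tri_le (s : Finset M.Edge) {X : M.Tri → ℝ} (hX : ∀ T, 0 ≤ X T) :
    ∑ e ∈ s, ∑ T with e.1 ⊆ T.1, X T ≤ 3 * ∑ T, X T := by
  simp only [Finset.sum_filter]
  rw [Finset.sum_comm, Finset.mul_sum]
  refine Finset.sum_le_sum fun T _ => ?_
  rw [← Finset.sum_filter, Finset.sum_const, nsmul_eq_mul]
  refine mul_le_mul_of_nonneg_right ?_ (hX T)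
  have hle : (s.filter fun e => e.1 ⊆ T.1).card ≤ (T.1.powersetCard 2).card := by
    refine Finset.card_le_card_of_injOn (fun e => e.1) (fun e he => ?_)
      (fun e _ e' _ h => Subtype.ext h)
    exact Finset.mem_coe.2 (Finset.mem_powersetCard.2 ⟨(Finset.mem_filter.1 he).2, e.2.2⟩)
  rw [Finset.card_powersetCard, T.2.2] at hle
  exact_mod_cast hle

theorem meshSize_pos {κ : ℝ} (hκ : 0 < κ) {h : M.Edge → ℝ} (hh : M.IsMeshSize κ h)
    (O : M.Orientation) (e : M.Edge) : 0 < h e :=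
  (mul_pos (inv_pos.2 hκ) (diam_cell_pos (O.minus e).2.2)).trans_le
    (hh e _ (O.subset_minus e)).1

theorem integrableOn_dotProduct_edge (e : M.Edge) {p q : Plane → Fin 3 → ℝ} (hp : Continuous p)
    (hq : Continuous q) : IntegrableOn (fun x => p x ⬝ᵥ q x) (edgeSet e.1) lengthMeasure :=
  integrableOn_of_continuous (hp.dotProduct hq) (measurableSet_edgeSet e.1) (isCompact_cell e.1)
    Set.sdiff_subset (lengthMeasure_edgeSet_lt_top e.2.2)

/-- The inverse trace estimate for the (piecewise constant) Hessian. -/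
theorem meshSize_mul_integral_averageHess_le {σ κ : ℝ} (hσ : 0 < σ) (hκ : 0 < κ)
    {h : M.Edge → ℝ} (hM : M.IsShapeRegular σ) (hh : M.IsMeshSize κ h) (O : M.Orientation)
    (y : M.DGSpace) (e : M.Edge) :
    h e * ∫ x in edgeSet e.1, O.averageHess y e x ⬝ᵥ O.averageHess y e x ∂lengthMeasure ≤
      ∑ T with e.1 ⊆ T.1, κ * (4 * σ ^ 2 / Real.pi) *
        (volume.real (cell T.1) * frobenius (hess y 0 T) (hess y 0 T)) := by
  have hhe := meshSize_pos hκ hh O e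
  have hconst : ∀ x, O.averageHess y e x = O.averageHess y e 0 := fun x => by
    have : hess y x = hess y 0 := funext (hess_eq y x 0)
    unfold Orientation.averageHess
    rw [this]
  have hint : ∫ x in edgeSet e.1, O.averageHess y e x ⬝ᵥ O.averageHess y e x ∂lengthMeasure =
      lengthMeasure.real (edgeSet e.1) * (O.averageHess y e 0 ⬝ᵥ O.averageHess y e 0) := by
    have : (fun x => O.averageHess y e x ⬝ᵥ O.averageHess y e x) =
        fun _ => O.averageHess y e 0 ⬝ᵥ O.averageHess y e 0 := funext fun x => by rw [hconst x]
    rw [this]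
    simp
  rw [hint, ← mul_assoc]
  refine (mul_le_mul_of_nonneg_left (averageHess_dotProduct_self_le O y e 0)
    (by positivity)).trans ?_
  rw [Finset.mul_sum]
  refine Finset.sum_le_sum fun T hT => ?_
  have heT : e.1 ⊆ T.1 := (Finset.mem_filter.1 hT).2
  obtain ⟨c, hc⟩ := hM T
  have h1 : h e * lengthMeasure.real (edgeSet e.1) ≤
      κ * Metric.diam (cell T.1) * Metric.diam (cell T.1) := by
    have := diam_cell_pos T.2.2
    gcongr
    · exact (hh e T heT).2
    · exact lengthMeasure_real_edgeSet_le e.2.2 heT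
  rw [← mul_assoc]
  refine mul_le_mul_of_nonneg_right (h1.trans ?_) (frobenius_self_nonneg _)
  rw [mul_assoc, ← pow_two, mul_assoc]
  gcongr
  exact diam_sq_le_volume_cell hσ hc

/-- The bilinear form controls the Hessian and both penalty terms once `η₁` is large compared with
the constant of the inverse trace estimate. -/
theorem le_bilinearForm_self {σ κ : ℝ} (hσ : 0 < σ) (hκ : 0 < κ)
    {h : M.Edge → ℝ} (hM : M.IsShapeRegular σ) (hh : M.IsMeshSize κ h) (O : M.Orientation)
    (ΓD : Set Plane) (η₀ : ℝ) {η₁ : ℝ} (hη₁ : 12 * (κ * (4 * σ ^ 2 / Real.pi)) ≤ η₁)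
    (y : M.DGSpace) :
    1 / 2 * ∑ T, volume.real (cell T.1) * frobenius (hess y 0 T) (hess y 0 T)
      + η₁ / 2 * (∑ e ∈ M.activeEdges ΓD,
          (h e)⁻¹ * ∫ x in edgeSet e.1, O.jumpGrad y e x ⬝ᵥ O.jumpGrad y e x ∂lengthMeasure)
      + η₀ * (∑ e ∈ M.activeEdges ΓD, ((h e) ^ 3)⁻¹ *
          ∫ x in edgeSet e.1, O.jumpValue y e x ⬝ᵥ O.jumpValue y e x ∂lengthMeasure)
      ≤ O.bilinearForm ΓD h η₀ η₁ y y := by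
  set C := κ * (4 * σ ^ 2 / Real.pi) with hC
  have hCpos : 0 < C := by have := Real.pi_pos; positivity
  have hη₁pos : 0 < η₁ := by linarith
  set X : M.Tri → ℝ := fun T => volume.real (cell T.1) * frobenius (hess y 0 T) (hess y 0 T)
    with hX
  have hX0 : ∀ T, 0 ≤ X T := fun T => mul_nonneg measureReal_nonneg (frobenius_self_nonneg _)
  have hvol : ∀ T : M.Tri, ∫ x in cell T.1, frobenius (hess y x T) (hess y x T) = X T := by
    intro T
    have : (fun x => frobenius (hess y x T) (hess y x T)) =
        fun _ => frobenius (hess y 0 T) (hess y 0 T) := funext fun x => by rw [hess_eq y x 0 T]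
    rw [this]
    simp [hX]
  have hyoung : ∀ e : M.Edge,
      2 * ∫ x in edgeSet e.1, O.jumpGrad y e x ⬝ᵥ O.averageHess y e x ∂lengthMeasure ≤
        η₁ / 2 * ((h e)⁻¹ *
          ∫ x in edgeSet e.1, O.jumpGrad y e x ⬝ᵥ O.jumpGrad y e x ∂lengthMeasure)
        + 2 / η₁ * ∑ T with e.1 ⊆ T.1, C * X T := by
    intro e
    have hhe := meshSize_pos hκ hh O e
    have hg := O.continuous_jumpGrad y e
    have ha := O.continuous_averageHess y e
    -- With this parameter Young's inequality uses up half of the gradient penalty.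
    set t := η₁ / 2 * (h e)⁻¹ with ht
    have htpos : 0 < t := by positivity
    have h1 : ∫ x in edgeSet e.1, 2 * (O.jumpGrad y e x ⬝ᵥ O.averageHess y e x) ∂lengthMeasure ≤
        ∫ x in edgeSet e.1, (t * (O.jumpGrad y e x ⬝ᵥ O.jumpGrad y e x)
          + t⁻¹ * (O.averageHess y e x ⬝ᵥ O.averageHess y e x)) ∂lengthMeasure :=
      integral_mono ((integrableOn_dotProduct_edge e hg ha).const_mul 2)
        (((integrableOn_dotProduct_edge e hg hg).const_mul t).add
          ((integrableOn_dotProduct_edge e ha ha).const_mul t⁻¹))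
        fun x => two_mul_dotProduct_le _ _ htpos
    rw [integral_const_mul, integral_add ((integrableOn_dotProduct_edge e hg hg).const_mul t)
          ((integrableOn_dotProduct_edge e ha ha).const_mul t⁻¹), integral_const_mul,
          integral_const_mul] at h1
    have h2 := mul_le_mul_of_nonneg_left
      (meshSize_mul_integral_averageHess_le hσ hκ hM hh O y e) (by positivity : 0 ≤ 2 / η₁)
    have h3 : t⁻¹ = 2 / η₁ * h e := by rw [ht]; field_simp
    rw [h3, ht, mul_assoc, mul_assoc (2 / η₁)] at h1
    exact h1.trans (add_le_add_right h2 _)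
  have hsum := Finset.sum_le_sum fun e (_ : e ∈ M.activeEdges ΓD) => hyoung e
  rw [← Finset.mul_sum, Finset.sum_add_distrib, ← Finset.mul_sum, ← Finset.mul_sum] at hsum
  have hover := sum_edge_sum_tri_le (M.activeEdges ΓD) (X := fun T => C * X T)
    fun T => mul_nonneg hCpos.le (hX0 T)
  rw [← Finset.mul_sum (a := C)] at hover
  have hS : 0 ≤ ∑ T, X T := Finset.sum_nonneg fun T _ => hX0 T
  have habsorb : 2 / η₁ * ∑ e ∈ M.activeEdges ΓD, ∑ T with e.1 ⊆ T.1, C * X T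
      ≤ 1 / 2 * ∑ T, X T := by
    calc _ ≤ 2 / η₁ * (3 * (C * ∑ T, X T)) := by gcongr
      _ = 6 * C / η₁ * ∑ T, X T := by ring
      _ ≤ 1 / 2 * ∑ T, X T := by
        refine mul_le_mul_of_nonneg_right ?_ hS
        rw [div_le_div_iff₀ hη₁pos two_pos]
        linarith
  simp only [Orientation.bilinearForm, hvol, integral_const_mul]
  linarith

end Triangulation

/-! ### Positive definiteness of the bilinear form -/


theorem eq_zero_of_mulVec_eq_zero {G : Matrix (Fin 3) (Fin 2) ℝ} {n t : Plane}
    (hnt : n 0 * t 0 + n 1 * t 1 = 0) (hn : n ≠ 0) (ht : t ≠ 0) (hGn : G *ᵥ n.ofLp = 0)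
    (hGt : G *ᵥ t.ofLp = 0) : G = 0 := by
  have hpos : ∀ v : Plane, v ≠ 0 → 0 < v 0 ^ 2 + v 1 ^ 2 := fun v hv => by
    have := EuclideanSpace.norm_sq_eq v
    simp only [Fin.sum_univ_two, Real.norm_eq_abs, sq_abs] at this
    rw [← this]
    have := norm_pos_iff.2 hv
    positivity
  have hdet : n 0 * t 1 - n 1 * t 0 ≠ 0 := by
    intro h0
    have h := mul_pos (hpos n hn) (hpos t ht)
    have : (n 0 ^ 2 + n 1 ^ 2) * (t 0 ^ 2 + t 1 ^ 2) =
        (n 0 * t 0 + n 1 * t 1) ^ 2 + (n 0 * t 1 - n 1 * t 0) ^ 2 := by ring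
    rw [this, hnt, h0] at h
    simp at h
  ext i j
  have h1 := congrFun hGn i
  have h2 := congrFun hGt i
  simp only [mulVec, dotProduct, Fin.sum_univ_two, Pi.zero_apply] at h1 h2
  refine (mul_eq_zero.1 (?_ : (n 0 * t 1 - n 1 * t 0) * G i j = 0)).resolve_left hdet
  fin_cases j
  · simp only [Fin.zero_eta]
    linear_combination (t 1) * h1 - (n 1) * h2
  · simp only [Fin.mk_one]
    linear_combination (n 0) * h2 - (t 0) * h1

namespace Triangulation

variable {Ω : Set Plane} {M : Triangulation Ω}

/-- For a piecewise affine field, vanishing of both jumps almost everywhere on an edge makes the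
jump of the two affine extensions vanish on the whole plane: the jump of the gradient vanishes in
the direction of the normal, and in the direction of the edge since the jump of the field has two
zeros there. -/
theorem jumpValue_eq_zero_of_ae (O : M.Orientation) {y : M.DGSpace}
    (hhess : ∀ T x, hess y x T = 0) (e : M.Edge)
    (hG : ∀ᵐ x ∂lengthMeasure.restrict (edgeSet e.1), O.jumpGrad y e x = 0)
    (hV : ∀ᵐ x ∂lengthMeasure.restrict (edgeSet e.1), O.jumpValue y e x = 0) (x : Plane) :
    O.jumpValue y e x = 0 := by
  obtain ⟨a, b, hab, he⟩ := Finset.card_eq_two.1 e.2.2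
  obtain ⟨c, hT, hc⟩ := exists_third_vertex (M.complex.indep (O.minus e).2.1) (O.minus e).2.2
    (O.subset_minus e) hab he
  obtain ⟨horth, hn0⟩ := outwardNormal_spec hab he hT hc
  obtain ⟨p, hp, q, hq, hpq, ⟨hGp, hVp⟩, -, hVq⟩ := exists_ne_of_ae_edgeSet e.2.2 (hG.and hV)
  obtain ⟨r, hr⟩ := exists_smul_of_mem_edgeSet he hp hq
  have haff : ∀ z, O.jumpValue y e z =
      O.jumpValue y e p + O.jump (grad y p) e *ᵥ (z - p).ofLp := by
    intro z
    have h := fun T => value_eq_of_hess_eq_zero (hhess T p) z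
    unfold Orientation.jumpValue Orientation.jump
    split_ifs
    · rw [h, h, sub_mulVec]; abel
    · rw [h]
  have hq' : O.jump (grad y p) e *ᵥ (q - p).ofLp = 0 := by
    have := haff q
    rwa [hVp, hVq, zero_add, eq_comm] at this
  have hG0 : O.jump (grad y p) e = 0 := by
    refine eq_zero_of_mulVec_eq_zero (n := O.normal e) (t := q - p) ?_ hn0
      (sub_ne_zero.2 hpq.symm) hGp hq'
    have h0 := horth
    rw [hr]
    change O.normal e 0 * _ + O.normal e 1 * _ = 0 at h0
    simp only [PiLp.smul_apply, smul_eq_mul]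
    linear_combination r * h0
  rw [haff x, hVp, hG0]
  simp

/-- A piecewise affine field without jumps on the active edges is zero: it vanishes on a triangle
at an active boundary edge, and the affine fields on the two sides of every internal edge agree. -/
theorem eq_zero_of_jump_eq_zero (hΩ : IsLipschitzDomain Ω)
    (hball : ∀ T : M.Tri, ∃ c r, 0 < r ∧ Metric.ball c r ⊆ cell T.1) (O : M.Orientation)
    {ΓD : Set Plane} (hne : (M.activeBoundary ΓD).Nonempty) {y : M.DGSpace}
    (hhess : ∀ T x, hess y x T = 0)
    (hG : ∀ e ∈ M.activeEdges ΓD,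
      ∀ᵐ x ∂lengthMeasure.restrict (edgeSet e.1), O.jumpGrad y e x = 0)
    (hV : ∀ e ∈ M.activeEdges ΓD,
      ∀ᵐ x ∂lengthMeasure.restrict (edgeSet e.1), O.jumpValue y e x = 0) : y = 0 := by
  have hjump : ∀ e ∈ M.activeEdges ΓD, ∀ x, O.jumpValue y e x = 0 := fun e he =>
    jumpValue_eq_zero_of_ae O hhess e (hG e he) (hV e he)
  obtain ⟨e₀, he₀⟩ := hne
  refine eq_zero_of_value_eq_zero (M.forall_of_edge_connected hΩ hball
    (P := fun T => ∀ x, value y x T = 0) (T₀ := O.minus e₀) (fun x => ?_) ?_)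
  · have h := hjump e₀ (Finset.mem_filter.2 ⟨Finset.mem_univ _, .inr he₀⟩) x
    have hnot : ¬ M.IsInterior e₀ := (Finset.mem_filter.1 he₀).2.1
    rwa [Orientation.jumpValue, Orientation.jump, if_neg hnot] at h
  · intro e T T' hTT' hT hT' h0 x
    have hint : M.IsInterior e := ⟨T, T', hTT', hT, hT'⟩
    have h := hjump e (Finset.mem_filter.2 ⟨Finset.mem_univ _, .inl hint⟩) x
    rw [Orientation.jumpValue, Orientation.jump, if_pos hint, sub_eq_zero] at h
    rcases M.eq_or_eq_of_edge_subset hT hT' (O.subset_minus e) hTT' with hm | hm <;>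
      rcases M.eq_or_eq_of_edge_subset hT hT' (O.subset_plus e) hTT' with hp | hp
    · exact absurd (hm.trans hp.symm) (O.minus_ne_plus e hint)
    · rw [hm, hp] at h
      rw [← h, h0]
    · rw [hm, hp] at h
      rw [h, h0]
    · exact absurd (hm.trans hp.symm) (O.minus_ne_plus e hint)

theorem ae_eq_zero_of_integral_dotProduct_self_eq_zero {e : M.Edge} {q : Plane → Fin 3 → ℝ}
    (hq : Continuous q) (h : ∫ x in edgeSet e.1, q x ⬝ᵥ q x ∂lengthMeasure = 0) :
    ∀ᵐ x ∂lengthMeasure.restrict (edgeSet e.1), q x = 0 := by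
  rw [integral_eq_zero_iff_of_nonneg (fun x => zero_le_dotProduct_self _)
    (integrableOn_dotProduct_edge e hq hq)] at h
  filter_upwards [h] with x hx
  exact dotProduct_self_eq_zero.1 hx

theorem bilinearForm_self_pos {σ κ : ℝ} (hσ : 0 < σ) (hκ : 0 < κ) (hΩ : IsLipschitzDomain Ω)
    {h : M.Edge → ℝ} (hM : M.IsShapeRegular σ) (hh : M.IsMeshSize κ h) (O : M.Orientation)
    {ΓD : Set Plane} (hne : (M.activeBoundary ΓD).Nonempty) {η₀ η₁ : ℝ} (hη₀ : 0 < η₀)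
    (hη₁ : 12 * (κ * (4 * σ ^ 2 / Real.pi)) ≤ η₁) {y : M.DGSpace} (hy : y ≠ 0) :
    0 < O.bilinearForm ΓD h η₀ η₁ y y := by
  refine lt_of_not_ge fun hle => hy ?_
  have hη₁pos : 0 < η₁ := by
    have := Real.pi_pos
    exact lt_of_lt_of_le (by positivity) hη₁
  have hhe := meshSize_pos hκ hh O
  have hlow := (le_bilinearForm_self hσ hκ hM hh O ΓD η₀ hη₁ y).trans hle
  have hdiam : ∀ T : M.Tri, 0 < Metric.diam (cell T.1) := fun T => diam_cell_pos T.2.2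
  have hvolpos : ∀ T : M.Tri, 0 < volume.real (cell T.1) := fun T => by
    obtain ⟨c, hc⟩ := hM T
    have h1 := diam_sq_le_volume_cell hσ hc
    have h2 := pow_pos (hdiam T) 2
    have := Real.pi_pos
    exact pos_of_mul_pos_right (h2.trans_le h1) (by positivity)
  have hA : ∀ T ∈ Finset.univ, 0 ≤ volume.real (cell (T : M.Tri).1) *
      frobenius (hess y 0 T) (hess y 0 T) := fun T _ =>
    mul_nonneg measureReal_nonneg (frobenius_self_nonneg _)
  have hB : ∀ e ∈ M.activeEdges ΓD, 0 ≤ (h e)⁻¹ *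
      ∫ x in edgeSet e.1, O.jumpGrad y e x ⬝ᵥ O.jumpGrad y e x ∂lengthMeasure := fun e _ =>
    mul_nonneg (inv_nonneg.2 (hhe e).le) (integral_nonneg fun x => zero_le_dotProduct_self _)
  have hC : ∀ e ∈ M.activeEdges ΓD, 0 ≤ ((h e) ^ 3)⁻¹ *
      ∫ x in edgeSet e.1, O.jumpValue y e x ⬝ᵥ O.jumpValue y e x ∂lengthMeasure := fun e _ =>
    mul_nonneg (inv_nonneg.2 (pow_pos (hhe e) 3).le)
      (integral_nonneg fun x => zero_le_dotProduct_self _)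
  have hA' := Finset.sum_nonneg hA
  have hB' := mul_nonneg (half_pos hη₁pos).le (Finset.sum_nonneg hB)
  have hC' := mul_nonneg hη₀.le (Finset.sum_nonneg hC)
  have hA0 := (Finset.sum_eq_zero_iff_of_nonneg hA).1 (by linarith)
  have hB0 := (Finset.sum_eq_zero_iff_of_nonneg hB).1
    ((mul_eq_zero.1 (by linarith : η₁ / 2 * _ = 0)).resolve_left (half_pos hη₁pos).ne')
  have hC0 := (Finset.sum_eq_zero_iff_of_nonneg hC).1
    ((mul_eq_zero.1 (by linarith : η₀ * _ = 0)).resolve_left hη₀.ne')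
  refine eq_zero_of_jump_eq_zero hΩ (fun T => ?_) O hne (fun T x => ?_) (fun e he => ?_)
    (fun e he => ?_)
  · obtain ⟨c, hc⟩ := hM T
    exact ⟨c, _, div_pos (hdiam T) (by positivity), Metric.ball_subset_closedBall.trans hc⟩
  · rw [hess_eq y x 0 T]
    exact frobenius_self_eq_zero
      ((mul_eq_zero.1 (hA0 T (Finset.mem_univ T))).resolve_left (hvolpos T).ne')
  · exact ae_eq_zero_of_integral_dotProduct_self_eq_zero (O.continuous_jumpGrad y e)
      ((mul_eq_zero.1 (hB0 e he)).resolve_left (inv_pos.2 (hhe e)).ne')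
  · exact ae_eq_zero_of_integral_dotProduct_self_eq_zero (O.continuous_jumpValue y e)
      ((mul_eq_zero.1 (hC0 e he)).resolve_left (inv_pos.2 (pow_pos (hhe e) 3)).ne')

end Triangulation

theorem isClosed_stiefel (n m : ℕ) : IsClosed (stiefel n m) :=
  isClosed_eq (continuous_id.matrix_transpose.matrix_mul continuous_id) continuous_const

end PlateDG

theorem mainTheorem8 (σ κ : ℝ) (hσ : 0 < σ) (hκ : 0 < κ) :
    ∃ ηmin : ℝ, 0 < ηmin ∧
      ∀ (Ω : Set PlateDG.Plane), PlateDG.IsLipschitzDomain Ω →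
      ∀ (ΓD : Set PlateDG.Plane), (∃ U : Set PlateDG.Plane, IsOpen U ∧ ΓD = frontier Ω ∩ U) →
      ∀ (f yD GD : PlateDG.Plane → PlateDG.Space),
        MemLp f 2 (volume.restrict Ω) →
        MemLp yD 2 (PlateDG.lengthMeasure.restrict ΓD) →
        MemLp GD 2 (PlateDG.lengthMeasure.restrict ΓD) →
      ∀ (M : PlateDG.Triangulation Ω) (O : M.Orientation) (h : M.Edge → ℝ),
        M.IsShapeRegular σ → M.IsMeshSize κ h → (M.activeBoundary ΓD).Nonempty →
      ∀ η₀ η₁ : ℝ, 0 < η₀ → ηmin ≤ η₁ →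
        M.admissible.Nonempty →
        ∃ y ∈ M.admissible,
          IsGLB (PlateDG.Triangulation.energy O ΓD h η₀ η₁ f yD GD '' M.admissible)
            (PlateDG.Triangulation.energy O ΓD h η₀ η₁ f yD GD y) := by
  have hpi := Real.pi_pos
  refine ⟨12 * (κ * (4 * σ ^ 2 / Real.pi)), by positivity, ?_⟩
  intro Ω hΩ ΓD _ f yD GD hf hyD hGD M O h hM hh hne η₀ η₁ hη₀ hη₁ hadm
  obtain ⟨B, hB⟩ := PlateDG.Triangulation.exists_bilinearForm_eq O ΓD h η₀ η₁
  obtain ⟨l, hl⟩ := PlateDG.Triangulation.exists_load_add_boundaryForm_eq O hΩ.isOpen h η₀ η₁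
    hf hyD hGD
  obtain ⟨L, hL⟩ := PlateDG.Triangulation.exists_grad_barycenter_eq M
  have hset : L ⁻¹' Set.univ.pi (fun _ => PlateDG.stiefel 3 2) = M.admissible := by
    ext y
    simp [PlateDG.Triangulation.admissible, hL]
  have henergy : ∀ y, PlateDG.Triangulation.energy O ΓD h η₀ η₁ f yD GD y =
      1 / 2 * B y y - l y := fun y => by
    rw [PlateDG.Triangulation.energy, hB, hl]; ring
  obtain ⟨y, hy, hmin⟩ := PlateDG.exists_isMinOn_quadratic B
    (fun v hv => by
      rw [hB]
      exact PlateDG.Triangulation.bilinearForm_self_pos hσ hκ hΩ hM hh O hne hη₀ hη₁ hv) l L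
    (isClosed_set_pi fun _ _ => PlateDG.isClosed_stiefel 3 2) (hset ▸ hadm)
  rw [hset] at hy hmin
  refine ⟨y, hy, IsLeast.isGLB ⟨⟨y, hy, rfl⟩, ?_⟩⟩
  rintro _ ⟨w, hw, rfl⟩
  rw [henergy, henergy]
  exact hmin hw
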